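/- Let $d\ge 1$ and let $\mathbb D$ be the open unit disc. The Hardy space $H^2(\mathbb D^d)$ is the Hilbert space of analytic functions $f$ on $\mathbb D^d$ with $$\|f\|^2=\sup_{0<r<1}\int_{\mathbb T^d}|f(r\zeta)|^2\,dm(\zeta)<\infty,$$ where $m$ is the normalized Haar measure of $\mathbb T^d$. For an ideal $I\subset\mathbb C[z_1,\dots,z_d]$ let $Z(I)\subset\mathbb C^d$ be its zero variety, let $[I]$ be the closure of $I$ in $H^2(\mathbb D^d)$, and let $[I]^\perp$ be its orthogonal complement, with the operators $S_{z_i}=P_{[I]^\perp}M_{z_i}|_{[I]^\perp}$, where $M_{z_i}$ is multiplication by $z_i$ and $P_{[I]^\perp}$ is the orthogonal projection onto $[I]^\perp$. The quotient module $[I]^\perp$ is called essentially normal if the commutators $[S_{z_i}^*,S_{z_j}]$, $1\le i,j\le d$, are all compact. For $u\in\partial\mathbb D^d$ put $V_u=\{\lambda u:\lambda\in\mathbb D\}$ and $\Lambda_u=\{k:|u_k|=1\}$. Let $I\subset\mathbb C[z_1,\dots,z_d]$ be a homogeneous ideal. (a) If $\dim_{\mathbb C}Z(I)\ge 2$, then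 $[I]^\perp$ is not essentially normal. (b) If $[I]^\perp$ is essentially normal and infinite-dimensional, then $Z(I)$ satisfies Condition A: $Z(I)\cap\mathbb D^d$ is a finite union $\bigcup_{i=1}^n V_{u_i}$ of pairwise different discs with $u_i\in\partial\mathbb D^d$, and, for every such representation, one of the following holds: 1) $\Lambda_{u_i}\ne\Lambda_{u_j}$ for all $i\ne j$; 2) for every pair $i\ne j$ with $\Lambda_{u_i}=\Lambda_{u_j}=\Lambda$, the vectors $(u_{i,k})_{k\in\Lambda}$ and $(u_{j,k})_{k\in\Lambda}$ in $\mathbb C^{\Lambda}$ are linearly independent. -/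

import Mathlib

open scoped ENNReal

namespace HardyPolydisc

/-- The open unit polydisc `𝔻^d` in `ℂ^d`. -/
def polydisc (d : ℕ) : Set (Fin d → ℂ) := {z | ∀ i, ‖z i‖ < 1}

/-- The monomial `z^α = z_1^{α_1} ⋯ z_d^{α_d}`. -/
def monom {d : ℕ} (α : Fin d →₀ ℕ) (z : Fin d → ℂ) : ℂ := ∏ i, z i ^ α i

/-- The point `r ζ` of `ℂ^d`, where `ζ ∈ 𝕋^d` has coordinates `exp (2 π i t_j)`. -/
noncomputable def torusPoint {d : ℕ} (r : ℝ) (t : UnitAddTorus (Fin d)) : Fin d → ℂ :=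
  fun i => (r : ℂ) * (AddCircle.toCircle (t i) : ℂ)

/-- The normalized Haar measure of the torus `𝕋^d`. -/
noncomputable def torusMeasure (d : ℕ) : MeasureTheory.Measure (UnitAddTorus (Fin d)) :=
  MeasureTheory.Measure.pi fun _ => AddCircle.haarAddCircle

instance (d : ℕ) : MeasureTheory.IsProbabilityMeasure (torusMeasure d) := by
  unfold torusMeasure
  infer_instance

/-- `sup_{0<r<1} ∫_{𝕋^d} |f(rζ)|² dm(ζ)`, with `m` the normalized Haar measure of the torus,
as an element of `[0, ∞]`. -/
noncomputable def hardySq {d : ℕ} (f : (Fin d → ℂ) → ℂ) : ℝ≥0∞ :=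
  ⨆ r ∈ Set.Ioo (0 : ℝ) 1, ∫⁻ t : UnitAddTorus (Fin d), ‖f (torusPoint r t)‖ₑ ^ 2 ∂(torusMeasure d)

theorem polydisc_eq_ball (d : ℕ) : polydisc d = Metric.ball 0 1 := by
  ext z
  simp [polydisc, pi_norm_lt_iff]

theorem summable_geometric_multi (d : ℕ) {q : ℝ} (h0 : 0 ≤ q) (h1 : q < 1) :
    Summable fun α : Fin d →₀ ℕ => q ^ α.degree := by
  have key : Summable fun α : Fin d → ℕ => ∏ i, q ^ α i := by
    refine summable_of_sum_le (c := ((1 - q)⁻¹) ^ d)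
      (fun α => Finset.prod_nonneg fun i _ => pow_nonneg h0 _) fun s => ?_
    let N := s.sup (fun α => ∑ i, α i) + 1
    have hs : s ⊆ Fintype.piFinset (fun _ : Fin d => Finset.range N) := by
      intro α hα
      rw [Fintype.mem_piFinset]
      intro i
      have h1 : α i ≤ ∑ i, α i := Finset.single_le_sum (fun _ _ => Nat.zero_le _) (Finset.mem_univ i)
      have h2 : ∑ i, α i ≤ s.sup (fun α => ∑ i, α i) :=
        Finset.le_sup (f := fun α : Fin d → ℕ => ∑ i, α i) hα
      simp only [Finset.mem_range, N]
      omega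
    calc ∑ α ∈ s, ∏ i, q ^ α i
        ≤ ∑ α ∈ Fintype.piFinset (fun _ : Fin d => Finset.range N), ∏ i, q ^ α i :=
          Finset.sum_le_sum_of_subset_of_nonneg hs
            fun α _ _ => Finset.prod_nonneg fun i _ => pow_nonneg h0 _
      _ = ∏ _i : Fin d, ∑ k ∈ Finset.range N, q ^ k :=
          (Finset.prod_univ_sum (fun _ : Fin d => Finset.range N) (fun _ k => q ^ k)).symm
      _ ≤ ∏ _i : Fin d, (1 - q)⁻¹ := by
          refine Finset.prod_le_prod (fun i _ => Finset.sum_nonneg fun k _ => pow_nonneg h0 _)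
            fun i _ => ?_
          rw [← tsum_geometric_of_lt_one h0 h1]
          exact (summable_geometric_of_lt_one h0 h1).sum_le_tsum _ (fun k _ => pow_nonneg h0 _)
      _ = ((1 - q)⁻¹) ^ d := by simp
  have := (Finsupp.equivFunOnFinite : (Fin d →₀ ℕ) ≃ (Fin d → ℕ)).summable_iff.2 key
  refine this.congr fun α => ?_
  simp [Finset.prod_pow_eq_pow_sum, Finsupp.degree_eq_sum]

theorem norm_monom_le {d : ℕ} (α : Fin d →₀ ℕ) {z : Fin d → ℂ} {q : ℝ} (hz : ‖z‖ ≤ q) :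
    ‖monom α z‖ ≤ q ^ α.degree := by
  rw [monom, norm_prod, Finsupp.degree_eq_sum, ← Finset.prod_pow_eq_pow_sum]
  refine Finset.prod_le_prod (fun i _ => norm_nonneg _) fun i _ => ?_
  rw [norm_pow]
  exact pow_le_pow_left₀ (norm_nonneg _) ((norm_le_pi_norm z i).trans hz) _

theorem monom_torusPoint {d : ℕ} (α : Fin d →₀ ℕ) (r : ℝ) (t : UnitAddTorus (Fin d)) :
    monom α (torusPoint r t) =
      (r : ℂ) ^ α.degree * UnitAddTorus.mFourier (fun i => (α i : ℤ)) t := by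
  rw [Finsupp.degree_eq_sum, ← Finset.prod_pow_eq_pow_sum]
  simp only [UnitAddTorus.mFourier, ContinuousMap.coe_mk, monom, torusPoint, mul_pow,
    ← Finset.prod_mul_distrib]
  refine Finset.prod_congr rfl fun i _ => ?_
  rw [fourier_apply, AddCircle.toCircle_zsmul]
  simp

theorem norm_torusPoint_le {d : ℕ} {r : ℝ} (hr : 0 ≤ r) (t : UnitAddTorus (Fin d)) :
    ‖torusPoint r t‖ ≤ r := by
  rw [pi_norm_le_iff_of_nonneg hr]
  intro i
  rw [torusPoint, norm_mul, Circle.norm_coe, mul_one, Complex.norm_real, Real.norm_of_nonneg hr]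

/-- Parseval's identity on the torus of radius `r`. -/
theorem lintegral_eq_of_hasSum {d : ℕ} {f : (Fin d → ℂ) → ℂ} {a : (Fin d →₀ ℕ) → ℂ} {r : ℝ}
    (hr : 0 ≤ r) (hs : Summable fun α => ‖a α‖ * r ^ α.degree)
    (hf : ∀ t : UnitAddTorus (Fin d),
      HasSum (fun α => a α * monom α (torusPoint r t)) (f (torusPoint r t))) :
    ∫⁻ t : UnitAddTorus (Fin d), ‖f (torusPoint r t)‖ₑ ^ 2 ∂(torusMeasure d) =
      ∑' α, ‖a α * (r : ℂ) ^ α.degree‖ₑ ^ 2 := by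
  set c : (Fin d →₀ ℕ) → ℂ := fun α => a α * (r : ℂ) ^ α.degree with hc
  set e : (Fin d →₀ ℕ) → (Fin d → ℤ) := fun α i => (α i : ℤ) with he
  have he_inj : Function.Injective e := by
    intro α β h
    ext i
    have := congrFun h i
    simpa [e] using this
  have hnc : ∀ α, ‖c α‖ = ‖a α‖ * r ^ α.degree := by
    intro α
    simp [c, abs_of_nonneg hr]
  have hsF : Summable fun α => c α • (UnitAddTorus.mFourier (e α) : C(UnitAddTorus (Fin d), ℂ)) := by
    refine Summable.of_norm ?_
    refine hs.congr fun α => ?_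
    rw [norm_smul, UnitAddTorus.mFourier_norm, mul_one, hnc]
  obtain ⟨F, hF⟩ := hsF
  have hFf : ∀ t, F t = f (torusPoint r t) := by
    intro t
    have h1 := ContinuousMap.hasSum_apply hF t
    refine h1.unique ?_
    convert! hf t using 2 with α
    rw [monom_torusPoint]
    simp [c, e, mul_assoc]
  have hL : HasSum (fun α => c α • ContinuousMap.toLp (E := ℂ) 2 (torusMeasure d) ℂ (UnitAddTorus.mFourier (e α)))
      (ContinuousMap.toLp (E := ℂ) 2 (torusMeasure d) ℂ F) := by
    have := hF.mapL (ContinuousMap.toLp (E := ℂ) 2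
      (torusMeasure d) ℂ)
    simpa using! this
  set G := ContinuousMap.toLp (E := ℂ) 2
    (torusMeasure d) ℂ F with hG
  have hon : Orthonormal ℂ fun α => ContinuousMap.toLp (E := ℂ) 2 (torusMeasure d) ℂ
        (UnitAddTorus.mFourier (e α)) :=
    UnitAddTorus.orthonormal_mFourier.comp e he_inj
  have hsq : HasSum (fun α => ‖c α‖ ^ 2) (‖G‖ ^ 2) := by
    have h1 : Filter.Tendsto (fun s : Finset (Fin d →₀ ℕ) =>
        ‖∑ α ∈ s, c α • ContinuousMap.toLp (E := ℂ) 2 (torusMeasure d) ℂ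
        (UnitAddTorus.mFourier (e α))‖ ^ 2) Filter.atTop
        (nhds (‖G‖ ^ 2)) := (Filter.Tendsto.norm hL).pow 2
    refine h1.congr fun s => ?_
    have h2 := hon.inner_sum c c s
    rw [inner_self_eq_norm_sq_to_K] at h2
    have h3 : ∀ α, (starRingEnd ℂ) (c α) * c α = ((‖c α‖ ^ 2 : ℝ) : ℂ) := by
      intro α
      rw [mul_comm, Complex.mul_conj, Complex.normSq_eq_norm_sq]
    simp_rw [h3] at h2
    rw [← Complex.ofReal_sum] at h2
    refine Complex.ofReal_injective ?_
    rw [← h2]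
    simp
  have hen : ∫⁻ t : UnitAddTorus (Fin d), ‖F t‖ₑ ^ 2 ∂(torusMeasure d) = ‖G‖ₑ ^ 2 := by
    rw [MeasureTheory.Lp.enorm_def, MeasureTheory.eLpNorm_congr_ae (ContinuousMap.coeFn_toLp _ F),
      MeasureTheory.eLpNorm_eq_lintegral_rpow_enorm_toReal (by simp) (by simp)]
    simp only [ENNReal.toReal_ofNat, ENNReal.rpow_ofNat]
    rw [← ENNReal.rpow_natCast, ← ENNReal.rpow_mul]
    simp
  simp_rw [← hFf]
  rw [hen]
  have h4 : ‖G‖ₑ ^ 2 = ENNReal.ofReal (‖G‖ ^ 2) := by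
    rw [ENNReal.ofReal_pow (norm_nonneg _), ofReal_norm]
  rw [h4, ← hsq.tsum_eq, ENNReal.ofReal_tsum_of_nonneg (fun _ => by positivity) hsq.summable]
  refine tsum_congr fun α => ?_
  rw [ENNReal.ofReal_pow (norm_nonneg _), ofReal_norm]

theorem torusPoint_mem {d : ℕ} {r : ℝ} (hr : r ∈ Set.Ioo (0 : ℝ) 1) (t : UnitAddTorus (Fin d)) :
    torusPoint r t ∈ polydisc d := by
  rw [polydisc_eq_ball, mem_ball_zero_iff]
  exact (norm_torusPoint_le hr.1.le t).trans_lt hr.2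

/-- The Hardy norm in terms of Taylor coefficients. -/
theorem hardySq_eq {d : ℕ} {f : (Fin d → ℂ) → ℂ} {a : (Fin d →₀ ℕ) → ℂ}
    (hs : ∀ r : ℝ, 0 ≤ r → r < 1 → Summable fun α => ‖a α‖ * r ^ α.degree)
    (hf : ∀ z ∈ polydisc d, HasSum (fun α => a α * monom α z) (f z)) :
    hardySq f = ∑' α, ‖a α‖ₑ ^ 2 := by
  have h1 : hardySq f = ⨆ r ∈ Set.Ioo (0 : ℝ) 1, ∑' α, ‖a α * (r : ℂ) ^ α.degree‖ₑ ^ 2 := by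
    refine iSup_congr fun r => iSup_congr fun hr => ?_
    exact lintegral_eq_of_hasSum hr.1.le (hs r hr.1.le hr.2) fun t => hf _ (torusPoint_mem hr t)
  rw [h1]
  refine le_antisymm (iSup₂_le fun r hr => ENNReal.tsum_le_tsum fun α => ?_) ?_
  · gcongr
    rw [enorm_mul]
    refine mul_le_of_le_one_right' ?_
    rw [← ofReal_norm, ENNReal.ofReal_le_one, norm_pow, Complex.norm_real,
      Real.norm_of_nonneg hr.1.le]
    exact pow_le_one₀ hr.1.le hr.2.le
  · rw [ENNReal.tsum_eq_iSup_sum]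
    refine iSup_le fun s => ?_
    have hc : Filter.Tendsto (fun r : ℝ => ∑ α ∈ s, ‖a α * (r : ℂ) ^ α.degree‖ₑ ^ 2)
        (nhdsWithin 1 (Set.Iio 1)) (nhds (∑ α ∈ s, ‖a α * ((1 : ℝ) : ℂ) ^ α.degree‖ₑ ^ 2)) := by
      refine Filter.Tendsto.mono_left (Continuous.tendsto ?_ 1) nhdsWithin_le_nhds
      fun_prop
    simp only [Complex.ofReal_one, one_pow, mul_one] at hc
    refine le_of_tendsto hc ?_
    filter_upwards [Ioo_mem_nhdsLT (zero_lt_one' ℝ)] with r hr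
    exact (ENNReal.sum_le_tsum s).trans
      (le_iSup₂ (f := fun (r : ℝ) (_ : r ∈ Set.Ioo (0 : ℝ) 1) =>
        ∑' α, ‖a α * (r : ℂ) ^ α.degree‖ₑ ^ 2) r hr)


theorem exists_prod_eq_monom {d : ℕ} (α : Fin d →₀ ℕ) :
    ∃ g : Fin α.degree → Fin d, ∀ z : Fin d → ℂ, ∏ t, z (g t) = monom α z := by
  have hlen : (Finsupp.toMultiset α).toList.length = α.degree := by
    rw [Multiset.length_toList, Finsupp.card_toMultiset, Finsupp.degree_apply, Finsupp.sum]
    rfl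
  refine ⟨fun t => (Finsupp.toMultiset α).toList.get (Fin.cast hlen.symm t), fun z => ?_⟩
  have h1 : ∏ t : Fin α.degree, z ((Finsupp.toMultiset α).toList.get (Fin.cast hlen.symm t)) =
      ((Finsupp.toMultiset α).toList.map z).prod := by
    rw [← Fin.prod_univ_getElem, ]
    refine Fintype.prod_equiv (finCongr (by simp [hlen])) _ _ fun t => ?_
    simp
  rw [h1, ← Multiset.prod_coe, ← Multiset.map_coe, Multiset.coe_toList, Finsupp.toMultiset_map,
    Finsupp.prod_toMultiset, Finsupp.prod_mapDomain_index (fun _ => pow_zero _)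
      (fun _ _ _ => pow_add _ _ _), Finsupp.prod_fintype _ _ (fun _ => pow_zero _)]
  rfl

theorem mem_antidiag {d k : ℕ} {α : Fin d →₀ ℕ} :
    α ∈ Finset.finsuppAntidiag Finset.univ k ↔ α.degree = k := by
  simp [Finset.mem_finsuppAntidiag, Finsupp.degree_eq_sum]

theorem hasSum_degree {d : ℕ} {F : (Fin d →₀ ℕ) → ℂ} {S : ℂ} (h : HasSum F S) :
    HasSum (fun k => ∑ α ∈ Finset.finsuppAntidiag Finset.univ k, F α) S := by
  have h1 := (Equiv.sigmaFiberEquiv (fun α : Fin d →₀ ℕ => α.degree)).hasSum_iff.2 h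
  refine h1.sigma fun k => ?_
  have h2 : HasSum (Set.indicator {α : Fin d →₀ ℕ | α.degree = k} F)
      (∑ α ∈ Finset.finsuppAntidiag Finset.univ k, F α) := by
    have h3 : ∑ α ∈ Finset.finsuppAntidiag Finset.univ k, F α =
        ∑ α ∈ Finset.finsuppAntidiag Finset.univ k,
          Set.indicator {α : Fin d →₀ ℕ | α.degree = k} F α := by
      refine Finset.sum_congr rfl fun α hα => ?_
      rw [Set.indicator_of_mem]
      exact mem_antidiag.1 hα
    rw [h3]
    refine hasSum_sum_of_ne_finset_zero fun α hα => ?_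
    rw [Set.indicator_of_notMem]
    exact fun h => hα (mem_antidiag.2 h)
  exact hasSum_subtype_iff_indicator.2 h2

theorem analyticOnNhd_of_hasSum {d : ℕ} {f : (Fin d → ℂ) → ℂ} {a : (Fin d →₀ ℕ) → ℂ}
    (hs : ∀ r : ℝ, 0 ≤ r → r < 1 → Summable fun α => ‖a α‖ * r ^ α.degree)
    (hf : ∀ z ∈ polydisc d, HasSum (fun α => a α * monom α z) (f z)) :
    AnalyticOnNhd ℂ f (polydisc d) := by
  have hM : ∀ (k : ℕ) (α : Fin d →₀ ℕ), ∃ M : ContinuousMultilinearMap ℂ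
      (fun _ : Fin k => Fin d → ℂ) ℂ, ‖M‖ ≤ 1 ∧
        (α.degree = k → ∀ z : Fin d → ℂ, (M fun _ => z) = monom α z) := by
    intro k α
    by_cases hk : α.degree = k
    · subst hk
      obtain ⟨g, hg⟩ := exists_prod_eq_monom α
      refine ⟨(ContinuousMultilinearMap.mkPiAlgebra ℂ (Fin α.degree) ℂ).compContinuousLinearMap
        fun t => ContinuousLinearMap.proj (R := ℂ) (φ := fun _ : Fin d => ℂ) (g t), ?_, ?_⟩
      · refine ContinuousMultilinearMap.opNorm_le_bound zero_le_one fun m => ?_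
        simp only [ContinuousMultilinearMap.compContinuousLinearMap_apply,
          ContinuousMultilinearMap.mkPiAlgebra_apply, ContinuousLinearMap.proj_apply, norm_prod,
          one_mul]
        exact Finset.prod_le_prod (fun _ _ => norm_nonneg _) fun t _ => norm_le_pi_norm (m t) (g t)
      · intro _ z
        simpa using hg z
    · exact ⟨0, by simp, fun h => absurd h hk⟩
  choose M hM1 hM2 using hM
  let p : FormalMultilinearSeries ℂ (Fin d → ℂ) ℂ := fun k =>
    ∑ α ∈ Finset.finsuppAntidiag Finset.univ k, a α • M k α
  have hball : HasFPowerSeriesOnBall f p 0 1 := by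
    refine ⟨?_, zero_lt_one, ?_⟩
    · refine ENNReal.le_of_forall_nnreal_lt fun r hr => ?_
      have hr1 : (r : ℝ) < 1 := by exact_mod_cast hr
      refine p.le_radius_of_bound (∑' α, ‖a α‖ * (r : ℝ) ^ α.degree) fun k => ?_
      have h1 : ‖p k‖ ≤ ∑ α ∈ Finset.finsuppAntidiag Finset.univ k, ‖a α‖ := by
        refine (norm_sum_le _ _).trans (Finset.sum_le_sum fun α _ => ?_)
        rw [norm_smul]
        exact mul_le_of_le_one_right (norm_nonneg _) (hM1 k α)
      calc ‖p k‖ * (r : ℝ) ^ k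
          ≤ (∑ α ∈ Finset.finsuppAntidiag Finset.univ k, ‖a α‖) * (r : ℝ) ^ k := by gcongr
        _ = ∑ α ∈ Finset.finsuppAntidiag Finset.univ k, ‖a α‖ * (r : ℝ) ^ α.degree := by
            rw [Finset.sum_mul]
            refine Finset.sum_congr rfl fun α hα => ?_
            rw [mem_antidiag.1 hα]
        _ ≤ _ := (hs r r.2 hr1).sum_le_tsum _ fun α _ => by positivity
    · intro y hy
      have hy' : y ∈ polydisc d := by
        rw [polydisc_eq_ball]
        rwa [← Metric.eball_ofReal, ENNReal.ofReal_one]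
      rw [zero_add]
      convert! hasSum_degree (hf y hy') using 2 with k
      simp only [p, sum_apply, smul_apply, smul_eq_mul]
      refine Finset.sum_congr rfl fun α hα => ?_
      rw [hM2 k α (mem_antidiag.1 hα)]
  rw [polydisc_eq_ball]
  intro z hz
  refine hball.analyticAt_of_mem ?_
  rwa [← ENNReal.ofReal_one, Metric.eball_ofReal]

/-- Expansion of an analytic function on the polydisc into a power series. -/
theorem exists_taylor {d : ℕ} {f : (Fin d → ℂ) → ℂ} (hf : AnalyticOnNhd ℂ f (polydisc d)) :
    ∃ a : (Fin d →₀ ℕ) → ℂ,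
      (∀ r : ℝ, 0 ≤ r → r < 1 → Summable fun α => ‖a α‖ * r ^ α.degree) ∧
      ∀ z ∈ polydisc d, HasSum (fun α => a α * monom α z) (f z) := by
  rw [polydisc_eq_ball] at hf ⊢
  obtain ⟨p, hp⟩ := hf 0 (Metric.mem_ball_self zero_lt_one)
  -- the homogeneous components along complex lines
  have hslice : ∀ (w : Fin d → ℂ), ‖w‖ ≤ 1 → ∀ ρ : NNReal, 0 < ρ → ρ < 1 →
      HasFPowerSeriesOnBall (fun l : ℂ => f (l • w))
        (cauchyPowerSeries (fun l : ℂ => f (l • w)) 0 ρ) 0 ρ ∧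
      ∀ k, (cauchyPowerSeries (fun l : ℂ => f (l • w)) 0 ρ k fun _ => 1) = p k fun _ => w := by
    intro w hw ρ h0 h1
    have hd : DifferentiableOn ℂ (fun l : ℂ => f (l • w)) (Metric.closedBall 0 ρ) := by
      intro l hl
      have hmem : l • w ∈ Metric.ball (0 : Fin d → ℂ) 1 := by
        rw [mem_ball_zero_iff, norm_smul]
        rw [mem_closedBall_zero_iff] at hl
        calc ‖l‖ * ‖w‖ ≤ ρ * 1 := by gcongr
          _ < 1 := by simpa using h1
      have := (hf _ hmem).differentiableAt
      exact (DifferentiableAt.comp l this (by fun_prop)).differentiableWithinAt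
    have hps := hd.hasFPowerSeriesOnBall h0
    refine ⟨hps, fun k => ?_⟩
    let u : ℂ →L[ℂ] (Fin d → ℂ) := (ContinuousLinearMap.id ℂ ℂ).smulRight w
    have hp' : HasFPowerSeriesAt f p (u 0) := by simpa using hp
    have h2 : HasFPowerSeriesAt (f ∘ u) (p.compContinuousLinearMap u) 0 := by
      obtain ⟨R, hR⟩ := hp'
      exact hR.compContinuousLinearMap.hasFPowerSeriesAt
    have h3 := hps.hasFPowerSeriesAt.eq_formalMultilinearSeries h2
    rw [h3, FormalMultilinearSeries.compContinuousLinearMap_apply]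
    congr 1
    ext i
    simp [u]
  have hsum : ∀ z ∈ Metric.ball (0 : Fin d → ℂ) 1, HasSum (fun k => p k fun _ => z) (f z) := by
    intro z hz
    rw [mem_ball_zero_iff] at hz
    obtain ⟨l, hl0, hl1⟩ := exists_between hz
    obtain ⟨ρ, hρ0, hρ1⟩ := exists_between hl1
    have hlpos : 0 < l := (norm_nonneg z).trans_lt hl0
    have hρpos : 0 < ρ := hlpos.trans hρ0
    have hl : (l : ℂ) ≠ 0 := by exact_mod_cast hlpos.ne'
    obtain ⟨w, hlw, hwn⟩ : ∃ w : Fin d → ℂ, (l : ℂ) • w = z ∧ ‖w‖ ≤ 1 := by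
      refine ⟨(l : ℂ)⁻¹ • z, smul_inv_smul₀ hl z, ?_⟩
      rw [norm_smul, norm_inv, Complex.norm_real, Real.norm_of_nonneg hlpos.le,
        inv_mul_le_one₀ hlpos]
      exact hl0.le
    obtain ⟨h1, h2⟩ := hslice w hwn (NNReal.mk ρ hρpos.le) hρpos hρ1
    have h3 := h1.hasSum (y := (l : ℂ)) (by
      rw [← ENNReal.ofReal_coe_nnreal, Metric.eball_ofReal, mem_ball_zero_iff, Complex.norm_real,
        Real.norm_of_nonneg hlpos.le]
      exact hρ0)
    rw [zero_add, hlw] at h3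
    convert! h3 using 2 with k
    have h4 : (fun _ : Fin k => (l : ℂ)) = fun _ => (l : ℂ) • (1 : ℂ) := by simp
    have h5 : (fun _ : Fin k => z) = fun _ => (l : ℂ) • w := by rw [hlw]
    rw [h5, (p k).map_smul_univ (fun _ => (l : ℂ)) (fun _ => w)]
    refine Eq.trans ?_ (congrArg _ h4).symm
    refine Eq.trans ?_ (ContinuousMultilinearMap.map_smul_univ _ (fun _ => (l : ℂ))
      (fun _ => (1 : ℂ))).symm
    rw [h2]
  have hbound : ∀ ρ : ℝ, 0 < ρ → ρ < 1 → ∃ C, 0 ≤ C ∧ ∀ (w : Fin d → ℂ), ‖w‖ ≤ 1 → ∀ k,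
      ‖p k fun _ => w‖ ≤ C * ρ⁻¹ ^ k := by
    intro ρ h0 h1
    obtain ⟨C, hC⟩ := (isCompact_closedBall (0 : Fin d → ℂ) ρ).exists_bound_of_continuousOn
      (hf.continuousOn.mono (Metric.closedBall_subset_ball h1))
    refine ⟨max C 0, le_max_right _ _, fun w hw k => ?_⟩
    have h2 := (hslice w hw (NNReal.mk ρ h0.le) h0 h1).2 k
    rw [← h2]
    refine (ContinuousMultilinearMap.le_opNorm _ _).trans ?_
    simp only [norm_one, Finset.prod_const_one, mul_one]
    refine (norm_cauchyPowerSeries_le _ _ _ _).trans ?_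
    rw [NNReal.coe_mk, abs_of_pos h0]
    refine mul_le_mul_of_nonneg_right ?_ (by positivity)
    have h3 : ‖∫ θ : ℝ in 0..2 * Real.pi, ‖f (circleMap 0 ρ θ • w)‖‖ ≤
        max C 0 * |2 * Real.pi - 0| := by
      refine intervalIntegral.norm_integral_le_of_norm_le_const fun θ _ => ?_
      rw [norm_norm]
      refine (hC _ ?_).trans (le_max_left _ _)
      rw [mem_closedBall_zero_iff, norm_smul, norm_circleMap_zero, abs_of_pos h0]
      exact mul_le_of_le_one_right h0.le hw
    rw [sub_zero, abs_of_pos Real.two_pi_pos] at h3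
    rw [inv_mul_le_iff₀ Real.two_pi_pos, mul_comm (2 * Real.pi)]
    exact (le_abs_self _).trans h3
  have hpoly : ∀ k, ∃ c : (Fin d →₀ ℕ) → ℂ, ∀ z, (p k fun _ => z) =
      ∑ α ∈ Finset.finsuppAntidiag Finset.univ k, c α * monom α z := by
    intro k
    let e : Fin d → (Fin d → ℂ) := fun j => Pi.single j 1
    let cnt : (Fin k → Fin d) → (Fin d →₀ ℕ) := fun i => ∑ t, Finsupp.single (i t) 1
    refine ⟨fun α => ∑ i with cnt i = α, p k fun t => e (i t), fun z => ?_⟩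
    have hz : (fun _ : Fin k => z) = fun _ => ∑ j, z j • e j := by
      funext _
      exact pi_eq_sum_univ' z
    have hcnt : ∀ i, cnt i ∈ Finset.finsuppAntidiag (Finset.univ : Finset (Fin d)) k := by
      intro i
      rw [mem_antidiag]
      simp [cnt]
    have hmon : ∀ i : Fin k → Fin d, ∏ t, z (i t) = monom (cnt i) z := by
      intro i
      have h1 : ∀ s : Finset (Fin k),
          ∏ t ∈ s, z (i t) = monom (∑ t ∈ s, Finsupp.single (i t) 1) z := by
        intro s
        classical
        induction s using Finset.induction_on with
        | empty => simp [monom]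
        | insert t s hts ih =>
          rw [Finset.prod_insert hts, Finset.sum_insert hts, ih]
          simp only [monom, Finsupp.add_apply, pow_add, Finset.prod_mul_distrib]
          congr 1
          rw [Finset.prod_eq_single (i t)]
          · simp
          · intro j _ hj
            simp [hj.symm]
          · simp
      exact h1 _
    rw [hz, ContinuousMultilinearMap.map_sum]
    simp only [ContinuousMultilinearMap.map_smul_univ, smul_eq_mul, hmon]
    rw [← Finset.sum_fiberwise_of_maps_to (fun i _ => hcnt i)]
    refine Finset.sum_congr rfl fun α _ => ?_
    rw [Finset.sum_mul]
    refine Finset.sum_congr rfl fun i hi => ?_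
    rw [(Finset.mem_filter.1 hi).2, mul_comm]
  choose c hc using hpoly
  have hcb : ∀ ρ : ℝ, 0 < ρ → ρ < 1 → ∃ C, 0 ≤ C ∧ ∀ α : Fin d →₀ ℕ,
      ‖c α.degree α‖ ≤ C * ρ⁻¹ ^ α.degree := by
    intro ρ h0 h1
    obtain ⟨C, hC0, hC⟩ := hbound ρ h0 h1
    refine ⟨C, hC0, fun α => ?_⟩
    set k := α.degree with hk
    let A : Finset (Fin d →₀ ℕ) := Finset.finsuppAntidiag Finset.univ k
    classical
    let b : (Fin d →₀ ℕ) → ℂ := fun β => if β ∈ A then c k β else 0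
    have hb0 : ∀ β ∉ A, b β = 0 := fun β hβ => if_neg hβ
    have hP := lintegral_eq_of_hasSum (f := fun z => p k fun _ => z) (a := b) (r := 1) zero_le_one
      (summable_of_ne_finset_zero (s := A) fun β hβ => by simp [hb0 β hβ]) (fun t => by
        rw [hc]
        have h2 : ∑ β ∈ A, c k β * monom β (torusPoint 1 t) =
            ∑ β ∈ A, b β * monom β (torusPoint 1 t) :=
          Finset.sum_congr rfl fun β hβ => by rw [show b β = c k β from if_pos hβ]
        rw [h2]
        exact hasSum_sum_of_ne_finset_zero fun β hβ => by rw [hb0 β hβ, zero_mul])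
    have hub : ∫⁻ t : UnitAddTorus (Fin d), ‖p k fun _ => torusPoint 1 t‖ₑ ^ 2 ∂(torusMeasure d) ≤
        ENNReal.ofReal (C * ρ⁻¹ ^ k) ^ 2 := by
      refine (MeasureTheory.lintegral_mono (g := fun _ => ENNReal.ofReal (C * ρ⁻¹ ^ k) ^ 2)
        fun t => ?_).trans (by simp)
      refine pow_le_pow_left₀ zero_le ?_ 2
      rw [← ofReal_norm]
      exact ENNReal.ofReal_le_ofReal (hC _ (norm_torusPoint_le zero_le_one t) k)
    rw [hP] at hub
    have h3 := (ENNReal.le_tsum α).trans hub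
    rw [show b α = c k α from if_pos (mem_antidiag.2 hk.symm)] at h3
    have h4 := (ENNReal.pow_le_pow_left_iff two_ne_zero).1 h3
    rw [← ofReal_norm, ENNReal.ofReal_le_ofReal_iff (by positivity)] at h4
    simpa using h4
  have hs : ∀ r : ℝ, 0 ≤ r → r < 1 → Summable fun α => ‖c α.degree α‖ * r ^ α.degree := by
    intro r h0 h1
    obtain ⟨ρ, hρ0, hρ1⟩ := exists_between h1
    have hρpos : 0 < ρ := h0.trans_lt hρ0
    obtain ⟨C, hC0, hC⟩ := hcb ρ hρpos hρ1
    have h2 : r / ρ < 1 := (div_lt_one hρpos).2 hρ0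
    refine Summable.of_nonneg_of_le (fun α => by positivity) (fun α => ?_)
      ((summable_geometric_multi d (by positivity) h2).mul_left C)
    calc ‖c α.degree α‖ * r ^ α.degree ≤ C * ρ⁻¹ ^ α.degree * r ^ α.degree := by
          gcongr
          exact hC α
      _ = C * (r / ρ) ^ α.degree := by rw [mul_assoc, ← mul_pow, div_eq_inv_mul]
  refine ⟨fun α => c α.degree α, hs, fun z hz => ?_⟩
  have hsz : Summable fun α => c α.degree α * monom α z := by
    rw [mem_ball_zero_iff] at hz
    refine Summable.of_norm_bounded (hs ‖z‖ (norm_nonneg z) hz) fun α => ?_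
    rw [norm_mul]
    gcongr
    exact norm_monom_le α le_rfl
  obtain ⟨S, hS⟩ := hsz
  have h1 := hasSum_degree hS
  have h2 : (fun k => ∑ α ∈ Finset.finsuppAntidiag Finset.univ k, c α.degree α * monom α z) =
      fun k => p k fun _ => z := by
    funext k
    rw [hc]
    refine Finset.sum_congr rfl fun α hα => ?_
    rw [mem_antidiag.1 hα]
  rw [h2] at h1
  rwa [(hsum z hz).unique h1]

/-- The square-summable families of coefficients indexed by multi-indices. -/
abbrev CoeffSpace (d : ℕ) : Type := lp (fun _ : Fin d →₀ ℕ => ℂ) 2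

/-- `f` is the sum of the power series with coefficients `a` on the polydisc. -/
def HasExpansion {d : ℕ} (f : (Fin d → ℂ) → ℂ) (a : CoeffSpace d) : Prop :=
  ∀ z ∈ polydisc d, HasSum (fun α => a α * monom α z) (f z)

theorem CoeffSpace.summable {d : ℕ} (a : CoeffSpace d) (r : ℝ) (h0 : 0 ≤ r) (h1 : r < 1) :
    Summable fun α => ‖a α‖ * r ^ α.degree := by
  refine Summable.of_nonneg_of_le (fun α => by positivity) (fun α => ?_)
    ((summable_geometric_multi d h0 h1).mul_left ‖a‖)
  gcongr
  exact lp.norm_apply_le_norm two_ne_zero a α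

theorem CoeffSpace.ofReal_norm_sq {d : ℕ} (a : CoeffSpace d) :
    ENNReal.ofReal (‖a‖ ^ 2) = ∑' α, ‖a α‖ₑ ^ 2 := by
  have h := lp.hasSum_norm (p := 2) (by simp) a
  simp only [ENNReal.toReal_ofNat, Real.rpow_ofNat] at h
  rw [← h.tsum_eq, ENNReal.ofReal_tsum_of_nonneg (fun _ => by positivity) h.summable]
  refine tsum_congr fun α => ?_
  rw [ENNReal.ofReal_pow (norm_nonneg _), ofReal_norm]

theorem HasExpansion.analytic {d : ℕ} {f : (Fin d → ℂ) → ℂ} {a : CoeffSpace d}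
    (h : HasExpansion f a) : AnalyticOnNhd ℂ f (polydisc d) :=
  analyticOnNhd_of_hasSum a.summable h

theorem HasExpansion.hardySq_eq {d : ℕ} {f : (Fin d → ℂ) → ℂ} {a : CoeffSpace d}
    (h : HasExpansion f a) : hardySq f = ENNReal.ofReal (‖a‖ ^ 2) := by
  rw [CoeffSpace.ofReal_norm_sq]
  exact HardyPolydisc.hardySq_eq a.summable h

theorem exists_expansion {d : ℕ} {f : (Fin d → ℂ) → ℂ} (hf : AnalyticOnNhd ℂ f (polydisc d))
    (h : hardySq f < ⊤) : ∃ a : CoeffSpace d, HasExpansion f a := by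
  obtain ⟨a, hs, ha⟩ := exists_taylor hf
  have hm : Memℓp a 2 := by
    rw [memℓp_gen_iff (by simp)]
    rw [HardyPolydisc.hardySq_eq hs ha] at h
    simp only [ENNReal.toReal_ofNat, Real.rpow_ofNat]
    have h2 := ENNReal.summable_toReal h.ne
    simpa using h2
  exact ⟨⟨a, hm⟩, ha⟩

theorem HasExpansion.add {d : ℕ} {f g : (Fin d → ℂ) → ℂ} {a b : CoeffSpace d}
    (hf : HasExpansion f a) (hg : HasExpansion g b) : HasExpansion (f + g) (a + b) := by
  intro z hz
  simpa [add_mul] using (hf z hz).add (hg z hz)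

theorem HasExpansion.smul {d : ℕ} {f : (Fin d → ℂ) → ℂ} {a : CoeffSpace d} (c : ℂ)
    (hf : HasExpansion f a) : HasExpansion (c • f) (c • a) := by
  intro z hz
  simpa [mul_assoc] using (hf z hz).mul_left c

theorem HasExpansion.zero (d : ℕ) : HasExpansion (0 : (Fin d → ℂ) → ℂ) 0 := by
  intro z hz
  simp

theorem HasExpansion.unique {d : ℕ} {f : (Fin d → ℂ) → ℂ} {a b : CoeffSpace d}
    (hf : HasExpansion f a) (hg : HasExpansion f b) : a = b := by
  have h := (hf.add (hg.smul (-1))).hardySq_eq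
  have h0 : f + (-1 : ℂ) • f = 0 := by simp
  rw [h0, (HasExpansion.zero d).hardySq_eq, norm_zero] at h
  have h1 : ‖a + (-1 : ℂ) • b‖ ^ 2 = 0 := by
    have := (ENNReal.ofReal_eq_ofReal_iff (by positivity) (by positivity)).1 h
    simpa using this.symm
  have h2 := norm_eq_zero.1 (pow_eq_zero_iff two_ne_zero |>.1 h1)
  rw [neg_one_smul, ← sub_eq_add_neg] at h2
  exact sub_eq_zero.1 h2

/-- The vector space of analytic functions `f` on the polydisc `𝔻^d` with
`sup_{0<r<1} ∫_{𝕋^d} |f(rζ)|² dm(ζ) < ∞`. A function on `𝔻^d` is represented by its extension by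
zero to `ℂ^d`. -/
def hardyFunctions (d : ℕ) : Submodule ℂ ((Fin d → ℂ) → ℂ) where
  carrier := {f | AnalyticOnNhd ℂ f (polydisc d) ∧ hardySq f < ⊤ ∧ ∀ z ∉ polydisc d, f z = 0}
  zero_mem' := by
    refine ⟨(HasExpansion.zero d).analytic, ?_, fun _ _ => rfl⟩
    rw [(HasExpansion.zero d).hardySq_eq]
    exact ENNReal.ofReal_lt_top
  add_mem' := by
    rintro f g ⟨hf, hf', hf0⟩ ⟨hg, hg', hg0⟩
    obtain ⟨a, ha⟩ := exists_expansion hf hf'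
    obtain ⟨b, hb⟩ := exists_expansion hg hg'
    refine ⟨hf.add hg, ?_, fun z hz => by simp [hf0 z hz, hg0 z hz]⟩
    rw [(ha.add hb).hardySq_eq]
    exact ENNReal.ofReal_lt_top
  smul_mem' := by
    rintro c f ⟨hf, hf', hf0⟩
    obtain ⟨a, ha⟩ := exists_expansion hf hf'
    refine ⟨(ha.smul c).analytic, ?_, fun z hz => by simp [hf0 z hz]⟩
    rw [(ha.smul c).hardySq_eq]
    exact ENNReal.ofReal_lt_top

/-- The Hardy space `H²(𝔻^d)`. -/
def HardySpace (d : ℕ) : Type := hardyFunctions d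

namespace HardySpace

variable {d : ℕ}

noncomputable instance : AddCommGroup (HardySpace d) :=
  inferInstanceAs (AddCommGroup (hardyFunctions d))

noncomputable instance : Module ℂ (HardySpace d) :=
  inferInstanceAs (Module ℂ (hardyFunctions d))

/-- The function on `ℂ^d` (zero off the polydisc) given by an element of `H²(𝔻^d)`. -/
def toFun (f : HardySpace d) : (Fin d → ℂ) → ℂ := (show hardyFunctions d from f).1

theorem toFun_mem (f : HardySpace d) : f.toFun ∈ hardyFunctions d :=
  (show hardyFunctions d from f).2

/-- An element of `H²(𝔻^d)` from a function. -/
def ofFun (f : (Fin d → ℂ) → ℂ) (hf : f ∈ hardyFunctions d) : HardySpace d :=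
  (⟨f, hf⟩ : hardyFunctions d)

@[simp]
theorem toFun_ofFun (f : (Fin d → ℂ) → ℂ) (hf : f ∈ hardyFunctions d) :
    (ofFun f hf).toFun = f := rfl

@[ext]
theorem ext {f g : HardySpace d} (h : ∀ z ∈ polydisc d, f.toFun z = g.toFun z) : f = g := by
  refine Subtype.ext (funext fun z => ?_)
  by_cases hz : z ∈ polydisc d
  · exact h z hz
  · exact (f.toFun_mem.2.2 z hz).trans (g.toFun_mem.2.2 z hz).symm

@[simp]
theorem toFun_add (f g : HardySpace d) : (f + g).toFun = f.toFun + g.toFun := rfl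

@[simp]
theorem toFun_smul (c : ℂ) (f : HardySpace d) : (c • f).toFun = c • f.toFun := rfl

@[simp]
theorem toFun_zero : (0 : HardySpace d).toFun = 0 := rfl

theorem exists_hasExpansion (f : HardySpace d) : ∃ a : CoeffSpace d, HasExpansion f.toFun a :=
  exists_expansion f.toFun_mem.1 f.toFun_mem.2.1

/-- The Taylor coefficients at the origin. -/
noncomputable def coeff (f : HardySpace d) : CoeffSpace d := f.exists_hasExpansion.choose

theorem hasExpansion (f : HardySpace d) : HasExpansion f.toFun f.coeff :=
  f.exists_hasExpansion.choose_spec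

theorem coeff_eq {f : HardySpace d} {a : CoeffSpace d} (h : HasExpansion f.toFun a) :
    f.coeff = a :=
  f.hasExpansion.unique h

theorem coeff_add (f g : HardySpace d) : (f + g).coeff = f.coeff + g.coeff :=
  coeff_eq (f.hasExpansion.add g.hasExpansion)

theorem coeff_smul (c : ℂ) (f : HardySpace d) : (c • f).coeff = c • f.coeff :=
  coeff_eq (f.hasExpansion.smul c)

theorem coeff_injective : Function.Injective (coeff : HardySpace d → CoeffSpace d) := by
  intro f g h
  ext z hz
  have h1 := f.hasExpansion z hz
  rw [h] at h1
  exact h1.unique (g.hasExpansion z hz)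

theorem coeff_surjective : Function.Surjective (coeff : HardySpace d → CoeffSpace d) := by
  classical
  intro a
  let f : (Fin d → ℂ) → ℂ := fun z => if z ∈ polydisc d then ∑' α, a α * monom α z else 0
  have hf : HasExpansion f a := by
    intro z hz
    have hz' : ‖z‖ < 1 := by rwa [polydisc_eq_ball, mem_ball_zero_iff] at hz
    have hs : Summable fun α => a α * monom α z := by
      refine Summable.of_norm_bounded (a.summable ‖z‖ (norm_nonneg z) hz') fun α => ?_
      rw [norm_mul]
      gcongr
      exact norm_monom_le α le_rfl
    simpa only [f, if_pos hz] using hs.hasSum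
  refine ⟨ofFun f ⟨hf.analytic, ?_, fun z hz => if_neg hz⟩, coeff_eq hf⟩
  rw [hf.hardySq_eq]
  exact ENNReal.ofReal_lt_top

/-- The linear isomorphism given by the Taylor coefficients. -/
noncomputable def coeffEquiv (d : ℕ) : HardySpace d ≃ₗ[ℂ] CoeffSpace d :=
  LinearEquiv.ofBijective
    { toFun := coeff, map_add' := coeff_add, map_smul' := coeff_smul }
    ⟨coeff_injective, coeff_surjective⟩

theorem coeffEquiv_apply (f : HardySpace d) : coeffEquiv d f = f.coeff := rfl

/-- `‖f‖² = sup_{0<r<1} ∫_{𝕋^d} |f(rζ)|² dm(ζ)`. -/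
noncomputable instance : Norm (HardySpace d) := ⟨fun f => Real.sqrt (hardySq f.toFun).toReal⟩

theorem norm_def (f : HardySpace d) : ‖f‖ = Real.sqrt (hardySq f.toFun).toReal := rfl

theorem norm_eq_norm_coeff (f : HardySpace d) : ‖f‖ = ‖coeffEquiv d f‖ := by
  rw [norm_def, f.hasExpansion.hardySq_eq, ENNReal.toReal_ofReal (by positivity),
    Real.sqrt_sq (norm_nonneg _), coeffEquiv_apply]

noncomputable instance : NormedAddCommGroup (HardySpace d) :=
  { (AddGroupNorm.toNormedAddCommGroup
      { toFun := fun f : HardySpace d => ‖f‖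
        map_zero' := by simp [norm_eq_norm_coeff]
        add_le' := fun f g => by
          simp only [norm_eq_norm_coeff, map_add]
          exact norm_add_le _ _
        neg' := fun f => by simp [norm_eq_norm_coeff]
        eq_zero_of_map_eq_zero' := fun f hf => by
          simpa [norm_eq_norm_coeff] using hf } : NormedAddCommGroup (HardySpace d)) with
    toNorm := inferInstance }

/-- The inner product inducing the norm; it is computed from the Taylor coefficients. -/
noncomputable instance : InnerProductSpace ℂ (HardySpace d) where
  norm_smul_le c f := by
    rw [norm_eq_norm_coeff, norm_eq_norm_coeff, map_smul]
    exact norm_smul_le _ _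
  inner f g := inner ℂ (coeffEquiv d f) (coeffEquiv d g)
  norm_sq_eq_re_inner f := by
    rw [norm_eq_norm_coeff]
    exact norm_sq_eq_re_inner _
  conj_inner_symm f g := inner_conj_symm _ _
  add_left f g h := by rw [map_add, inner_add_left]
  smul_left f g c := by rw [map_smul, inner_smul_left]

/-- Taking Taylor coefficients is a unitary map of `H²(𝔻^d)` onto `ℓ²`. -/
noncomputable def coeffIso (d : ℕ) : HardySpace d ≃ₗᵢ[ℂ] CoeffSpace d :=
  ⟨coeffEquiv d, fun f => (norm_eq_norm_coeff f).symm⟩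

instance : CompleteSpace (HardySpace d) :=
  (completeSpace_congr (e := (coeffIso d).toEquiv) (coeffIso d).isometry.isUniformEmbedding).2
    inferInstance

end HardySpace

theorem hardySq_mono {d : ℕ} {f g : (Fin d → ℂ) → ℂ} (h : ∀ z ∈ polydisc d, ‖g z‖ ≤ ‖f z‖) :
    hardySq g ≤ hardySq f := by
  refine iSup₂_mono fun r hr => MeasureTheory.lintegral_mono fun t => ?_
  refine pow_le_pow_left₀ zero_le ?_ 2
  rw [← ofReal_norm, ← ofReal_norm]
  exact ENNReal.ofReal_le_ofReal (h _ (torusPoint_mem hr t))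

/-- Multiplication by the coordinate function `z_i` on `H²(𝔻^d)`. -/
noncomputable def mulCoord {d : ℕ} (i : Fin d) : HardySpace d →L[ℂ] HardySpace d :=
  have hle : ∀ f : HardySpace d, hardySq (fun z => z i * f.toFun z) ≤ hardySq f.toFun :=
    fun f => hardySq_mono fun z hz => by
      rw [norm_mul]
      exact mul_le_of_le_one_left (norm_nonneg _) (hz i).le
  LinearMap.mkContinuous
    { toFun := fun f => HardySpace.ofFun (fun z => z i * f.toFun z)
        ⟨fun z hz => ((ContinuousLinearMap.proj (R := ℂ) (φ := fun _ : Fin d => ℂ) i).analyticAt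
            z).mul (f.toFun_mem.1 z hz),
          (hle f).trans_lt f.toFun_mem.2.1,
          fun z hz => by simp [f.toFun_mem.2.2 z hz]⟩
      map_add' := fun f g => by
        ext z _
        exact mul_add (z i) (f.toFun z) (g.toFun z)
      map_smul' := fun c f => by
        ext z _
        exact mul_left_comm (z i) c (f.toFun z) }
    1 fun f => by
      rw [one_mul]
      exact Real.sqrt_le_sqrt (ENNReal.toReal_mono f.toFun_mem.2.1.ne (hle f))

open Classical in
/-- A polynomial, viewed as an element of `H²(𝔻^d)`. -/
noncomputable def ofPoly (d : ℕ) : MvPolynomial (Fin d) ℂ →ₗ[ℂ] HardySpace d where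
  toFun p := HardySpace.ofFun (fun z => if z ∈ polydisc d then MvPolynomial.eval z p else 0) <| by
    have hpa : AnalyticOnNhd ℂ (fun z : Fin d → ℂ => MvPolynomial.eval z p) Set.univ :=
      AnalyticOnNhd.eval_mvPolynomial p
    have hopen : IsOpen (polydisc d) := by
      rw [polydisc_eq_ball]
      exact Metric.isOpen_ball
    refine ⟨?_, ?_, fun z hz => if_neg hz⟩
    · refine (hpa.mono (Set.subset_univ _)).congr hopen fun z hz => ?_
      exact (if_pos hz).symm
    · obtain ⟨C, hC⟩ := (isCompact_closedBall (0 : Fin d → ℂ) 1).exists_bound_of_continuousOn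
        (hpa.continuousOn.mono (Set.subset_univ _))
      refine lt_of_le_of_lt (b := ENNReal.ofReal C ^ 2) ?_ (by simp)
      refine iSup₂_le fun r hr => ?_
      refine (MeasureTheory.lintegral_mono (g := fun _ => ENNReal.ofReal C ^ 2)
        fun t => ?_).trans (by simp)
      refine pow_le_pow_left₀ zero_le ?_ 2
      simp only [if_pos (torusPoint_mem hr t)]
      rw [← ofReal_norm]
      refine ENNReal.ofReal_le_ofReal (hC _ ?_)
      rw [mem_closedBall_zero_iff]
      exact (norm_torusPoint_le hr.1.le t).trans hr.2.le
  map_add' p q := by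
    ext z hz
    rw [HardySpace.toFun_add, Pi.add_apply]
    simp only [HardySpace.toFun, HardySpace.ofFun, if_pos hz, map_add]
  map_smul' c p := by
    ext z hz
    rw [HardySpace.toFun_smul, Pi.smul_apply]
    simp only [HardySpace.toFun, HardySpace.ofFun, if_pos hz, MvPolynomial.smul_eval, smul_eq_mul,
      RingHom.id_apply]

/-- `[I]`: the closure of the ideal `I` in `H²(𝔻^d)`. -/
noncomputable def closureIdeal {d : ℕ} (I : Ideal (MvPolynomial (Fin d) ℂ)) :
    Submodule ℂ (HardySpace d) :=
  ((I.restrictScalars ℂ).map (ofPoly d)).topologicalClosure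

/-- The compression `S_{z_i} = P_N M_{z_i}|_N` to a closed subspace `N` of `H²(𝔻^d)`. -/
noncomputable def compression {d : ℕ} (N : Submodule ℂ (HardySpace d)) [CompleteSpace N]
    (i : Fin d) : N →L[ℂ] N :=
  N.orthogonalProjectionOnto ∘L mulCoord i ∘L N.subtypeL

/-- All commutators `[S_{z_i}^*, S_{z_j}]` are compact operators on `N`. -/
def EssentiallyNormal {d : ℕ} (N : Submodule ℂ (HardySpace d)) [CompleteSpace N] : Prop :=
  ∀ i j : Fin d, IsCompactOperator
    (ContinuousLinearMap.adjoint (compression N i) ∘L compression N j -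
      compression N j ∘L ContinuousLinearMap.adjoint (compression N i))

/-- The dimension of an affine variety `Z ⊆ ℂ^d`: the Krull dimension of its coordinate ring
(`⊥` if `Z` is empty). -/
noncomputable def varietyDim {d : ℕ} (Z : Set (Fin d → ℂ)) : WithBot ℕ∞ :=
  ringKrullDim (MvPolynomial (Fin d) ℂ ⧸ MvPolynomial.vanishingIdeal ℂ Z)

/-- The disc `V_u = {λ u : λ ∈ 𝔻}`. -/
def disc {d : ℕ} (u : Fin d → ℂ) : Set (Fin d → ℂ) := {z | ∃ l : ℂ, ‖l‖ < 1 ∧ z = l • u}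

/-- `Λ_u`: the set of indices of the unimodular coordinates of `u`. -/
def unimodularSet {d : ℕ} (u : Fin d → ℂ) : Set (Fin d) := {k | ‖u k‖ = 1}

/-- `Z ∩ 𝔻^d` is the union of the pairwise different discs `V_{u_1}, …, V_{u_n}` with
`u_i ∈ ∂𝔻^d`. -/
def IsDiscDecomposition {d n : ℕ} (Z : Set (Fin d → ℂ)) (u : Fin n → Fin d → ℂ) : Prop :=
  (∀ i, u i ∈ frontier (polydisc d)) ∧ (∀ i j, i ≠ j → disc (u i) ≠ disc (u j)) ∧
    Z ∩ polydisc d = ⋃ i, disc (u i)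

/-- `Z ∩ 𝔻^d` is a finite union of different discs `V_{u_i}`, `u_i ∈ ∂𝔻^d`, and, for every such
representation, either the sets `Λ_i` are pairwise different, or for all `i ≠ j` with `Λ_i = Λ_j`
the restrictions of `u_i` and `u_j` to `Λ_i` are linearly independent. -/
def ConditionA {d : ℕ} (Z : Set (Fin d → ℂ)) : Prop :=
  (∃ (n : ℕ) (u : Fin n → Fin d → ℂ), IsDiscDecomposition Z u) ∧
  ∀ (n : ℕ) (u : Fin n → Fin d → ℂ), IsDiscDecomposition Z u →
    (∀ i j, i ≠ j → unimodularSet (u i) ≠ unimodularSet (u j)) ∨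
    (∀ i j, i ≠ j → unimodularSet (u i) = unimodularSet (u j) →
      LinearIndependent ℂ ![fun k : unimodularSet (u i) => u i k,
        fun k : unimodularSet (u i) => u j k])

end HardyPolydisc

attribute [local instance] MvPolynomial.gradedAlgebra

/-!
Write `Z` for the zero variety of the homogeneous ideal `I` and `N = [I]ᗮ`. Everything follows from
one separation property of `Z`, `EssentiallyNormal.eq_of_unimodular_eq`: if `N` is essentially
normal, a point `u ∈ Z` with `max_k |u_k| = 1` is determined, among such points with the same set of
unimodular coordinates, by the values of these coordinates.

The reproducing kernel `K_a` of a zero `a ∈ Z ∩ 𝔻^d` lies in `N` and satisfies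
`S_i^* K_a = conj a_i K_a`. Hence, for the normalized kernel `k_a`, the number
`⟨[S_i^*, S_i] k_a, k_a⟩` is `‖(S_i - a_i) k_a‖²`, and pairing with `k_b` for a second zero `b`
bounds `|b_i - a_i| |⟨k_b, k_a⟩|`. As `a` tends to the boundary, `k_a` tends weakly to zero, so a compact
commutator forces this product to tend to zero. For `a = r u` and `b = r v` with `r → 1`, where `u`
and `v` have equal unimodular coordinates, `|⟨k_b, k_a⟩|` stays away from zero, whence `u = v`.

The separation property makes `Z` a finite union of lines. Otherwise some ratio `z_k / z_j` takes
infinitely many values on `Z`, and `Z` contains a holomorphic curve parametrized by this ratio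
(`exists_holomorphic_curve`): adjoin to `ℂ(t)` a point of `Z` with coordinates `z_j = 1`,
`z_k = t`, write the extension with an integral primitive element, and specialize the primitive
element to a holomorphic branch of simple roots of its minimal polynomial. Near a point of the curve
where the number of coordinates of largest modulus is minimal, these coordinates remain the largest,
so their ratios have modulus one and are constant by the maximum principle. By separation the curve
is projectively constant there, which contradicts the parametrization
(`EssentiallyNormal.finite_ratio`).

A finite union of lines has dimension at most one, which gives the first assertion. For the second,
an infinite-dimensional `N` forces `Z ≠ {0}` by the Nullstellensatz, the lines meet the polydisc in
discs, and two discs with the same unimodular coordinate set and linearly dependent unimodular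
coordinates coincide, since after a rotation of one of the points the separation property applies.
-/

namespace HardyPolydisc

open Filter Topology

/-! ### Reproducing kernels of the Hardy space -/

/-- The multivariate geometric series `∑_α a^α b^α`. -/
theorem hasSum_monom_mul {d : ℕ} {a b : Fin d → ℂ} (ha : a ∈ polydisc d) (hb : b ∈ polydisc d) :
    HasSum (fun α => monom α a * monom α b) (∏ k, (1 - a k * b k)⁻¹) := by
  -- the absolute convergence is carried along the induction, as the product formula needs it
  have key : ∀ (n : ℕ) (c : Fin n → ℂ), (∀ i, ‖c i‖ < 1) →
      Summable (fun α : Fin n → ℕ => ‖∏ i, c i ^ α i‖) ∧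
      HasSum (fun α : Fin n → ℕ => ∏ i, c i ^ α i) (∏ i, (1 - c i)⁻¹) := by
    intro n
    induction n with
    | zero => intro c _; exact ⟨Summable.of_finite, by simp⟩
    | succ n ih =>
      intro c hc
      obtain ⟨h1, h2⟩ := ih (fun i => c i.succ) fun i => hc _
      have h3 := hasSum_geometric_of_norm_lt_one (hc 0)
      have h4 : Summable fun k : ℕ => ‖c 0 ^ k‖ := by
        simpa using summable_geometric_of_lt_one (norm_nonneg _) (hc 0)
      have h5 := h4.mul_norm h1
      have h6 := h3.mul h2 h5.of_norm
      have e : (fun x : ℕ × (Fin n → ℕ) => c 0 ^ x.1 * ∏ i : Fin n, c i.succ ^ x.2 i) =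
          (fun α : Fin (n + 1) → ℕ => ∏ i, c i ^ α i) ∘ Fin.consEquiv (fun _ => ℕ) := by
        ext x
        simp [Fin.prod_univ_succ]
      rw [← (Fin.consEquiv (fun _ : Fin (n + 1) => ℕ)).hasSum_iff, ← e,
        ← (Fin.consEquiv (fun _ : Fin (n + 1) => ℕ)).summable_iff, Fin.prod_univ_succ]
      refine ⟨?_, h6⟩
      have e' : (fun x : ℕ × (Fin n → ℕ) => ‖c 0 ^ x.1 * ∏ i : Fin n, c i.succ ^ x.2 i‖) =
          (fun α : Fin (n + 1) → ℕ => ‖∏ i, c i ^ α i‖) ∘ Fin.consEquiv (fun _ => ℕ) := by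
        ext x
        simp [Fin.prod_univ_succ]
      rw [← e']
      exact h5
  have h := (key d (fun k => a k * b k) fun i => by
    rw [norm_mul]
    exact mul_lt_one_of_nonneg_of_lt_one_left (norm_nonneg _) (ha i) (hb i).le).2
  refine ((Finsupp.equivFunOnFinite : (Fin d →₀ ℕ) ≃ (Fin d → ℕ)).hasSum_iff.2 h).congr_fun ?_
  intro α
  simp [monom, Finset.prod_mul_distrib, mul_pow]

theorem memℓp_monom {d : ℕ} {a : Fin d → ℂ} (ha : a ∈ polydisc d) :
    Memℓp (fun α => (starRingEnd ℂ) (monom α a)) 2 := by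
  rw [memℓp_gen_iff (by simp)]
  have := (hasSum_monom_mul ha ha).summable.norm
  simpa [sq] using this

/-- The reproducing kernel `K_a` of `H²(𝔻^d)` at a point `a` of the polydisc. -/
noncomputable def kernel {d : ℕ} {a : Fin d → ℂ} (ha : a ∈ polydisc d) : HardySpace d :=
  (HardySpace.coeffIso d).symm ⟨fun α => (starRingEnd ℂ) (monom α a), memℓp_monom ha⟩

theorem coeff_kernel {d : ℕ} {a : Fin d → ℂ} (ha : a ∈ polydisc d) (α : Fin d →₀ ℕ) :
    (kernel ha).coeff α = (starRingEnd ℂ) (monom α a) := by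
  have : (kernel ha).coeff = ⟨fun α => (starRingEnd ℂ) (monom α a), memℓp_monom ha⟩ :=
    (HardySpace.coeffIso d).apply_symm_apply _
  rw [this]

theorem inner_eq_inner_coeff {d : ℕ} (f g : HardySpace d) :
    inner ℂ f g = inner ℂ f.coeff g.coeff := rfl

/-- The reproducing property. -/
theorem inner_kernel_left {d : ℕ} {a : Fin d → ℂ} (ha : a ∈ polydisc d) (f : HardySpace d) :
    inner ℂ (kernel ha) f = f.toFun a := by
  rw [inner_eq_inner_coeff]
  refine (lp.hasSum_inner _ _).unique ((f.hasExpansion a ha).congr_fun fun α => ?_)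
  rw [coeff_kernel]
  simp

/-- The closed form of the kernel, of which the value at `b` is `⟨K_b, K_a⟩`. -/
theorem kernel_toFun {d : ℕ} {a b : Fin d → ℂ} (ha : a ∈ polydisc d) (hb : b ∈ polydisc d) :
    (kernel ha).toFun b = ∏ k, (1 - (starRingEnd ℂ) (a k) * b k)⁻¹ := by
  have ha' : (fun k => (starRingEnd ℂ) (a k)) ∈ polydisc d := fun k => by simpa using ha k
  refine ((kernel ha).hasExpansion b hb).unique ((hasSum_monom_mul ha' hb).congr_fun fun α => ?_)
  rw [coeff_kernel]
  simp [monom]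

theorem norm_kernel_sq {d : ℕ} {a : Fin d → ℂ} (ha : a ∈ polydisc d) :
    ‖kernel ha‖ ^ 2 = ∏ k, (1 - ‖a k‖ ^ 2)⁻¹ := by
  have h := inner_self_eq_norm_sq_to_K (𝕜 := ℂ) (kernel ha)
  rw [inner_kernel_left, kernel_toFun ha ha] at h
  have : ∀ k, (1 - (starRingEnd ℂ) (a k) * a k)⁻¹ = (((1 - ‖a k‖ ^ 2)⁻¹ : ℝ) : ℂ) := fun k => by
    rw [mul_comm, Complex.mul_conj, Complex.normSq_eq_norm_sq]
    push_cast
    rfl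
  simp_rw [this, ← Complex.ofReal_prod] at h
  have h2 := Complex.ofReal_injective (h.trans (Complex.ofReal_pow _ _).symm)
  exact h2.symm

theorem ofPoly_toFun {d : ℕ} (p : MvPolynomial (Fin d) ℂ) {z : Fin d → ℂ} (hz : z ∈ polydisc d) :
    (ofPoly d p).toFun z = MvPolynomial.eval z p := if_pos hz

theorem mulCoord_toFun {d : ℕ} (i : Fin d) (f : HardySpace d) (z : Fin d → ℂ) :
    (mulCoord i f).toFun z = z i * f.toFun z := rfl

/-- The Taylor coefficients of the polynomial `z^α` are those of a basis vector of `ℓ²`. -/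
theorem coeff_ofPoly_monomial {d : ℕ} (α : Fin d →₀ ℕ) (c : ℂ) :
    (ofPoly d (MvPolynomial.monomial α c)).coeff = lp.single 2 α c := by
  classical
  refine HardySpace.coeff_eq fun z hz => ?_
  rw [ofPoly_toFun _ hz]
  have := hasSum_single (f := fun β => (lp.single 2 α c : CoeffSpace d) β * monom β z) α
    fun β hβ => by simp [lp.single_apply, hβ]
  convert! this using 1
  simp [MvPolynomial.eval_monomial, monom, Finsupp.prod_fintype]

theorem inner_ofPoly_monomial {d : ℕ} (α : Fin d →₀ ℕ) (f : HardySpace d) :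
    inner ℂ (ofPoly d (MvPolynomial.monomial α 1)) f = f.coeff α := by
  classical
  rw [inner_eq_inner_coeff, coeff_ofPoly_monomial, lp.inner_single_left]
  simp

theorem dense_range_ofPoly (d : ℕ) : DenseRange (ofPoly d) := by
  classical
  intro f
  have h := lp.hasSum_single (p := 2) (by simp) f.coeff
  have h2 : HasSum (fun α => ofPoly d (MvPolynomial.monomial α (f.coeff α))) f := by
    have h3 := h.mapL ((HardySpace.coeffIso d).symm.toContinuousLinearEquiv :
      CoeffSpace d →L[ℂ] HardySpace d)
    have e : ∀ g : HardySpace d, (HardySpace.coeffIso d).symm g.coeff = g :=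
      fun g => (HardySpace.coeffIso d).symm_apply_apply g
    convert! h3 using 1
    · ext1 α
      rw [← coeff_ofPoly_monomial]
      exact (e _).symm
    · exact (e f).symm
  refine mem_closure_of_tendsto h2 (Eventually.of_forall fun s => ?_)
  exact ⟨∑ α ∈ s, MvPolynomial.monomial α (f.coeff α), map_sum _ _ _⟩

/-- The kernel at a zero of the ideal lies in the quotient module. -/
theorem kernel_mem {d : ℕ} {I : Ideal (MvPolynomial (Fin d) ℂ)} {a : Fin d → ℂ}
    (ha : a ∈ polydisc d) (hZ : a ∈ MvPolynomial.zeroLocus ℂ I) :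
    kernel ha ∈ (closureIdeal I)ᗮ := by
  rw [closureIdeal, Submodule.orthogonal_closure, Submodule.mem_orthogonal]
  rintro _ ⟨p, hp, rfl⟩
  rw [← inner_conj_symm, inner_kernel_left, ofPoly_toFun _ ha]
  have := hZ p hp
  rw [MvPolynomial.aeval_eq_eval] at this
  simp [this]

/-- A compact operator maps a weakly null bounded family to a norm null family. -/
theorem tendsto_of_isCompactOperator {ι E : Type*} [NormedAddCommGroup E] [InnerProductSpace ℂ E]
    [CompleteSpace E] {l : Filter ι} {k : ι → E} {T : E →L[ℂ] E} (hT : IsCompactOperator T)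
    (hk : ∀ᶠ i in l, ‖k i‖ ≤ 1) (hw : ∀ f, Tendsto (fun i => inner ℂ f (k i)) l (𝓝 0)) :
    Tendsto (fun i => T (k i)) l (𝓝 0) := by
  obtain ⟨K, hK, hTK⟩ := hT.image_closedBall_subset_compact 1
  refine hK.tendsto_nhds_of_unique_mapClusterPt ?_ fun w _ hw' => ?_
  · filter_upwards [hk] with i hi
    exact hTK ⟨k i, by simpa using hi, rfl⟩
  · -- a cluster point `w` of `T (k i)` is orthogonal to itself, as `⟨w, T (k i)⟩ = ⟨T* w, k i⟩`
    have h1 : MapClusterPt (inner ℂ w w) l fun i => inner ℂ w (T (k i)) :=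
      hw'.continuousAt_comp (f := fun x => inner ℂ w x) (by fun_prop)
    have h2 : Tendsto (fun i => inner ℂ w (T (k i))) l (𝓝 0) := by
      simpa [ContinuousLinearMap.adjoint_inner_left] using hw (ContinuousLinearMap.adjoint T w)
    have h3 : inner ℂ w w = (0 : ℂ) := by
      by_contra hne
      have := (disjoint_nhds_nhds.2 hne).mono_right h2
      exact h1.ne this.eq_bot
    exact inner_self_eq_zero.1 h3

/-! ### Essential normality separates points of the variety -/

/-- If `x` is an eigenvector of `S*` with eigenvalue `conj c`, the self-commutator of `S`
measures how far `x` is from being an eigenvector of `S`. -/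
theorem norm_sub_smul_sq_eq {E : Type*} [NormedAddCommGroup E] [InnerProductSpace ℂ E]
    [CompleteSpace E] (S : E →L[ℂ] E) {x : E} {c : ℂ}
    (h : ContinuousLinearMap.adjoint S x = (starRingEnd ℂ) c • x) :
    ‖S x - c • x‖ ^ 2 = (inner ℂ x ((ContinuousLinearMap.adjoint S ∘L S -
      S ∘L ContinuousLinearMap.adjoint S) x)).re := by
  have h1 : inner ℂ x (S x) = c * inner ℂ x x := by
    rw [← ContinuousLinearMap.adjoint_inner_left, h, inner_smul_left, Complex.conj_conj]
  have h2 : inner ℂ (S x) x = (starRingEnd ℂ) c * inner ℂ x x := by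
    rw [← inner_conj_symm, h1, map_mul, inner_conj_symm]
  have key : inner ℂ (S x - c • x) (S x - c • x) = inner ℂ x ((ContinuousLinearMap.adjoint S ∘L S -
      S ∘L ContinuousLinearMap.adjoint S) x) := by
    simp only [sub_apply, ContinuousLinearMap.comp_apply, h, map_smul, inner_sub_left,
      inner_sub_right, inner_smul_left, inner_smul_right,
      ContinuousLinearMap.adjoint_inner_right, h1, h2]
    ring
  rw [← key, inner_self_eq_norm_sq_to_K]
  norm_cast

section Quotient

variable {d : ℕ} {I : Ideal (MvPolynomial (Fin d) ℂ)}

/-- As for the whole Hardy space, the kernel at a zero of the ideal is an eigenvector of the adjoint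
of each compressed coordinate multiplication. -/
theorem adjoint_compression_kernel (i : Fin d) {a : Fin d → ℂ} (ha : a ∈ polydisc d)
    (hZ : a ∈ MvPolynomial.zeroLocus ℂ I) :
    ContinuousLinearMap.adjoint (compression (closureIdeal I)ᗮ i) ⟨kernel ha, kernel_mem ha hZ⟩ =
      (starRingEnd ℂ) (a i) • ⟨kernel ha, kernel_mem ha hZ⟩ := by
  refine ext_inner_right ℂ fun f => ?_
  rw [ContinuousLinearMap.adjoint_inner_left, inner_smul_left, Complex.conj_conj,
    Submodule.coe_inner, inner_kernel_left]
  simp only [compression, ContinuousLinearMap.comp_apply, Submodule.subtypeL_apply]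
  have h := Submodule.inner_orthogonalProjectionOnto_eq_of_mem_left
    (⟨kernel ha, kernel_mem ha hZ⟩ : (closureIdeal I)ᗮ) (mulCoord i (f : HardySpace d))
  rw [Submodule.coe_inner, inner_kernel_left, inner_kernel_left, mulCoord_toFun] at h
  rw [h, Submodule.coe_inner, inner_kernel_left]

/-- For zeros `a`, `b` of the ideal, the self-commutator of `S_{z_i}` at the kernel `K_a` bounds the
`i`-th coordinate of `b - a`, weighted by `|⟨K_b, K_a⟩|²`. -/
theorem norm_sub_mul_inner_kernel_le (i : Fin d) {a b : Fin d → ℂ} (ha : a ∈ polydisc d)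
    (hb : b ∈ polydisc d) (hZa : a ∈ MvPolynomial.zeroLocus ℂ I)
    (hZb : b ∈ MvPolynomial.zeroLocus ℂ I) (S : (closureIdeal I)ᗮ →L[ℂ] (closureIdeal I)ᗮ)
    (hS : S = compression (closureIdeal I)ᗮ i) :
    ‖b i - a i‖ ^ 2 * ‖inner ℂ (kernel hb) (kernel ha)‖ ^ 2 ≤ ‖kernel hb‖ ^ 2 * (‖kernel ha‖ *
      ‖(ContinuousLinearMap.adjoint S ∘L S - S ∘L ContinuousLinearMap.adjoint S)
        ⟨kernel ha, kernel_mem ha hZa⟩‖) := by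
  set x : (closureIdeal I)ᗮ := ⟨kernel ha, kernel_mem ha hZa⟩ with hx
  set y : (closureIdeal I)ᗮ := ⟨kernel hb, kernel_mem hb hZb⟩ with hy
  have hxS : ContinuousLinearMap.adjoint S x = (starRingEnd ℂ) (a i) • x := by
    rw [hS]; exact adjoint_compression_kernel i ha hZa
  have hyS : ContinuousLinearMap.adjoint S y = (starRingEnd ℂ) (b i) • y := by
    rw [hS]; exact adjoint_compression_kernel i hb hZb
  have hxn : ‖kernel ha‖ = ‖x‖ := rfl
  have hyn : ‖kernel hb‖ = ‖y‖ := rfl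
  have hxy : inner ℂ (kernel hb) (kernel ha) = inner ℂ y x := rfl
  rw [hxn, hyn, hxy, ← mul_pow, ← norm_mul]
  have h1 : (b i - a i) * inner ℂ y x = inner ℂ y (S x - a i • x) := by
    rw [inner_sub_right, inner_smul_right, ← ContinuousLinearMap.adjoint_inner_left, hyS,
      inner_smul_left, Complex.conj_conj, sub_mul]
  rw [h1]
  calc ‖inner ℂ y (S x - a i • x)‖ ^ 2 ≤ (‖y‖ * ‖S x - a i • x‖) ^ 2 := by
        gcongr
        exact norm_inner_le_norm _ _
    _ = ‖y‖ ^ 2 * ‖S x - a i • x‖ ^ 2 := mul_pow _ _ _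
    _ ≤ _ := by
        rw [norm_sub_smul_sq_eq S hxS]
        gcongr
        exact (Complex.re_le_norm _).trans (norm_inner_le_norm _ _)

/-- Essential normality forces zeros of the ideal that tend to the boundary at bounded hyperbolic
distance from each other to be asymptotically equal. -/
theorem EssentiallyNormal.tendsto_sub (hN : EssentiallyNormal (closureIdeal I)ᗮ)
    {a b : ℕ → Fin d → ℂ} (ha : ∀ n, a n ∈ polydisc d) (hb : ∀ n, b n ∈ polydisc d)
    (hZa : ∀ n, a n ∈ MvPolynomial.zeroLocus ℂ I) (hZb : ∀ n, b n ∈ MvPolynomial.zeroLocus ℂ I)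
    (hlim : Tendsto (fun n => ‖kernel (ha n)‖) atTop atTop) {c : ℝ} (hc : 0 < c)
    (hbd : ∀ n, c * (‖kernel (hb n)‖ ^ 2 * ‖kernel (ha n)‖ ^ 2) ≤
      ‖inner ℂ (kernel (hb n)) (kernel (ha n))‖ ^ 2) (i : Fin d) :
    Tendsto (fun n => ‖b n i - a n i‖ ^ 2) atTop (𝓝 0) := by
  set S := compression (closureIdeal I)ᗮ i with hS
  set T := ContinuousLinearMap.adjoint S ∘L S - S ∘L ContinuousLinearMap.adjoint S with hTdef
  have hT : IsCompactOperator T := hN i i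
  let x : ℕ → (closureIdeal I)ᗮ := fun n => ⟨kernel (ha n), kernel_mem (ha n) (hZa n)⟩
  let k : ℕ → (closureIdeal I)ᗮ := fun n => ((‖kernel (ha n)‖⁻¹ : ℝ) : ℂ) • x n
  have hpos : ∀ {z : Fin d → ℂ} (hz : z ∈ polydisc d), 0 < ‖kernel hz‖ := by
    intro z hz
    refine norm_pos_iff.2 fun h => ?_
    have h1 := norm_kernel_sq hz
    rw [h, norm_zero] at h1
    have h2 : 0 < ∏ k, (1 - ‖z k‖ ^ 2)⁻¹ := Finset.prod_pos fun k _ => by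
      have := pow_lt_one₀ (norm_nonneg (z k)) (hz k) two_ne_zero
      exact inv_pos.2 (by linarith)
    rw [← h1] at h2
    norm_num at h2
  have hk1 : ∀ n, ‖k n‖ ≤ 1 := by
    intro n
    have hxn : ‖x n‖ = ‖kernel (ha n)‖ := rfl
    simp only [k, norm_smul, hxn]
    simp [(hpos (ha n)).ne']
  have hweak : ∀ f, Tendsto (fun n => inner ℂ f (k n)) atTop (𝓝 0) := by
    -- by density it suffices to test against polynomials, which are bounded on the polydisc
    intro f
    rw [Metric.tendsto_nhds]
    intro ε hε
    obtain ⟨p, hp⟩ := (dense_range_ofPoly d).exists_dist_lt (f : HardySpace d) (half_pos hε)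
    obtain ⟨C, hC⟩ := (isCompact_closedBall (0 : Fin d → ℂ) 1).exists_bound_of_continuousOn
      (f := fun z => MvPolynomial.eval z p) (MvPolynomial.continuous_eval p).continuousOn
    have h0 : Tendsto (fun n => ‖kernel (ha n)‖⁻¹ * C) atTop (𝓝 0) := by
      simpa using (hlim.inv_tendsto_atTop).mul_const C
    filter_upwards [h0.eventually_lt_const (half_pos hε)] with n hn
    rw [dist_zero_right]
    have e1 : inner ℂ f (k n) = inner ℂ ((f : HardySpace d) - ofPoly d p) (k n : HardySpace d) +
        inner ℂ (ofPoly d p) (k n : HardySpace d) := by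
      rw [← inner_add_left, sub_add_cancel]; rfl
    have e2 : ‖inner ℂ (ofPoly d p) (k n : HardySpace d)‖ ≤ ‖kernel (ha n)‖⁻¹ * C := by
      have : (k n : HardySpace d) = ((‖kernel (ha n)‖⁻¹ : ℝ) : ℂ) • kernel (ha n) := rfl
      rw [this, inner_smul_right, norm_mul, Complex.norm_real, Real.norm_of_nonneg (by positivity),
        ← inner_conj_symm, RCLike.norm_conj, inner_kernel_left, ofPoly_toFun _ (ha n)]
      gcongr
      refine hC _ ?_
      have := ha n
      rw [polydisc_eq_ball] at this
      exact Metric.ball_subset_closedBall this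
    have e3 : ‖inner ℂ ((f : HardySpace d) - ofPoly d p) (k n : HardySpace d)‖ ≤ ε / 2 := by
      refine (norm_inner_le_norm _ _).trans ?_
      rw [← dist_eq_norm]
      exact (mul_le_of_le_one_right dist_nonneg (hk1 n)).trans hp.le
    rw [e1]
    exact (norm_add_le _ _).trans_lt (by linarith)
  have hTk := (tendsto_of_isCompactOperator hT (Eventually.of_forall hk1) hweak).norm
  rw [norm_zero] at hTk
  have hup : Tendsto (fun n => c⁻¹ * ‖T (k n)‖) atTop (𝓝 0) := by simpa using hTk.const_mul c⁻¹
  refine squeeze_zero (fun n => by positivity) (fun n => ?_) hup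
  have h1 := norm_sub_mul_inner_kernel_le i (ha n) (hb n) (hZa n) (hZb n) S hS
  have h2 : ‖T (k n)‖ = ‖kernel (ha n)‖⁻¹ * ‖T (x n)‖ := by
    simp [k, norm_smul]
  change _ ≤ ‖kernel (hb n)‖ ^ 2 * (‖kernel (ha n)‖ * ‖T (x n)‖) at h1
  have hA := hpos (ha n)
  have hB := hpos (hb n)
  rw [h2]
  have h3 := mul_le_mul_of_nonneg_left (hbd n) (sq_nonneg ‖b n i - a n i‖)
  rw [le_inv_mul_iff₀ hc, le_inv_mul_iff₀ hA]
  have hAB : 0 < ‖kernel (hb n)‖ ^ 2 * ‖kernel (ha n)‖ := by positivity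
  refine le_of_mul_le_mul_left ?_ hAB
  linarith

/-- Essential normality separates the discs in the zero variety: a boundary point of the polydisc
in the variety is determined by its unimodular coordinates. -/
theorem EssentiallyNormal.eq_of_unimodular_eq (hN : EssentiallyNormal (closureIdeal I)ᗮ)
    (hcone : ∀ z ∈ MvPolynomial.zeroLocus ℂ I, ∀ c : ℂ, c • z ∈ MvPolynomial.zeroLocus ℂ I)
    {u v : Fin d → ℂ} (hu : u ∈ MvPolynomial.zeroLocus ℂ I) (hv : v ∈ MvPolynomial.zeroLocus ℂ I)
    (hu1 : ‖u‖ = 1) (hv1 : ‖v‖ = 1) (hset : ∀ k, ‖u k‖ = 1 ↔ ‖v k‖ = 1)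
    (heq : ∀ k, ‖u k‖ = 1 → u k = v k) : u = v := by
  -- the points approach `u` and `v` radially, staying inside the polydisc and the cone
  let r : ℕ → ℝ := fun n => 1 - 1 / ((n : ℝ) + 1 + 1)
  have hr0 : ∀ n, 0 ≤ r n := fun n => by
    have : 1 / ((n : ℝ) + 1 + 1) ≤ 1 := by
      rw [div_le_one (by positivity)]
      linarith [(Nat.cast_nonneg n : (0 : ℝ) ≤ n)]
    simp only [r]; linarith
  have hr1 : ∀ n, r n < 1 := fun n => by
    have : 0 < 1 / ((n : ℝ) + 1 + 1) := by positivity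
    simp only [r]; linarith
  have hrlim : Tendsto r atTop (𝓝 1) := by
    have h := (tendsto_add_atTop_iff_nat 1).2 (tendsto_one_div_add_atTop_nhds_zero_nat (𝕜 := ℝ))
    have := h.const_sub 1
    simpa [r] using this
  have hmem : ∀ w : Fin d → ℂ, ‖w‖ = 1 → ∀ n, ((r n : ℝ) : ℂ) • w ∈ polydisc d := by
    intro w hw n
    rw [polydisc_eq_ball, mem_ball_zero_iff, norm_smul, hw, mul_one, Complex.norm_real,
      Real.norm_of_nonneg (hr0 n)]
    exact hr1 n
  have hle : ∀ w : Fin d → ℂ, ‖w‖ = 1 → ∀ k, ‖w k‖ ≤ 1 := fun w hw k => hw ▸ norm_le_pi_norm w k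
  have hnrm : ∀ (w : Fin d → ℂ) n k, ‖(((r n : ℝ) : ℂ) • w) k‖ ^ 2 = r n ^ 2 * ‖w k‖ ^ 2 := by
    intro w n k
    rw [Pi.smul_apply, norm_smul, Complex.norm_real, Real.norm_of_nonneg (hr0 n), mul_pow]
  have hr2 : ∀ n, r n ^ 2 < 1 := fun n => pow_lt_one₀ (hr0 n) (hr1 n) two_ne_zero
  have hpos : ∀ (w : Fin d → ℂ), ‖w‖ = 1 → ∀ n k, 0 < 1 - r n ^ 2 * ‖w k‖ ^ 2 := by
    intro w hw n k
    have := mul_le_of_le_one_right (sq_nonneg (r n)) (pow_le_one₀ (norm_nonneg _) (hle w hw k) :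
      ‖w k‖ ^ 2 ≤ 1)
    linarith [hr2 n]
  obtain ⟨k0, hk0⟩ : ∃ k, ‖u k‖ = 1 := by
    by_contra! hne
    have : ‖u‖ < 1 := (pi_norm_lt_iff one_pos).2 fun k => lt_of_le_of_ne (hle u hu1 k) (hne k)
    exact this.ne hu1
  -- the product of the `c k` bounds the squared cosine of the angle between the kernels from below:
  -- unimodular coordinates contribute exactly `1`, and at the others `|1 - conj a_k b_k| ≤ 2`
  let c : Fin d → ℝ := fun k => if ‖u k‖ = 1 then 1 else (1 - ‖u k‖ ^ 2) * (1 - ‖v k‖ ^ 2) / 4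
  have hlt : ∀ (w : Fin d → ℂ), ‖w‖ = 1 → ∀ k, ‖w k‖ ≠ 1 → 0 < 1 - ‖w k‖ ^ 2 := by
    intro w hw k hk
    have := pow_lt_one₀ (norm_nonneg _) (lt_of_le_of_ne (hle w hw k) hk) two_ne_zero
    linarith
  have hcpos : ∀ k, 0 < c k := by
    intro k
    simp only [c]
    split_ifs with hk
    · exact one_pos
    · have h1 := hlt u hu1 k hk
      have h2 := hlt v hv1 k fun h => hk ((hset k).2 h)
      positivity
  have hmain := hN.tendsto_sub (a := fun n => ((r n : ℝ) : ℂ) • u)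
    (b := fun n => ((r n : ℝ) : ℂ) • v)
    (hmem u hu1) (hmem v hv1) (fun n => hcone u hu _) (fun n => hcone v hv _) ?_
    (c := ∏ k, c k) (Finset.prod_pos fun k _ => hcpos k) ?_
  · funext i
    have h1 : Tendsto (fun n => ‖((r n : ℝ) : ℂ) * v i - ((r n : ℝ) : ℂ) * u i‖ ^ 2) atTop
        (𝓝 (‖((1 : ℝ) : ℂ) * v i - ((1 : ℝ) : ℂ) * u i‖ ^ 2)) := by
      have : Continuous fun x : ℝ => ‖(x : ℂ) * v i - (x : ℂ) * u i‖ ^ 2 := by fun_prop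
      exact (this.tendsto 1).comp hrlim
    have h2 := tendsto_nhds_unique h1 (hmain i)
    simp only [Complex.ofReal_one, one_mul] at h2
    have h3 := norm_eq_zero.1 (pow_eq_zero_iff two_ne_zero |>.1 h2)
    exact (sub_eq_zero.1 h3).symm
  · -- the factor of a unimodular coordinate alone makes the norm of the kernel blow up
    have h1 : Tendsto (fun n => (1 - r n ^ 2)⁻¹) atTop atTop := by
      refine Tendsto.inv_tendsto_nhdsGT_zero ?_
      rw [tendsto_nhdsWithin_iff]
      refine ⟨?_, Eventually.of_forall fun n => by simpa using hr2 n⟩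
      simpa using (hrlim.pow 2).const_sub 1
    have h2 : Tendsto (fun n => ‖kernel (hmem u hu1 n)‖ ^ 2) atTop atTop := by
      refine tendsto_atTop_mono (fun n => ?_) h1
      rw [norm_kernel_sq, ← Finset.mul_prod_erase _ _ (Finset.mem_univ k0), hnrm, hk0, one_pow,
        mul_one]
      refine le_mul_of_one_le_right (inv_nonneg.2 (by linarith [hr2 n])) ?_
      refine Finset.one_le_prod fun k _ => ?_
      rw [hnrm]
      refine (one_le_inv₀ (hpos u hu1 n k)).2 ?_
      have : 0 ≤ r n ^ 2 * ‖u k‖ ^ 2 := by positivity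
      linarith
    refine (Real.tendsto_sqrt_atTop.comp h2).congr fun n => ?_
    simp
  · intro n
    rw [norm_kernel_sq, norm_kernel_sq, inner_kernel_left, kernel_toFun _ (hmem v hv1 n), norm_prod,
      ← Finset.prod_pow, ← Finset.prod_mul_distrib, ← Finset.prod_mul_distrib]
    refine Finset.prod_le_prod (fun k _ => ?_) fun k _ => ?_
    · rw [hnrm, hnrm]
      have h1 := hcpos k
      have h2 := hpos u hu1 n k
      have h3 := hpos v hv1 n k
      positivity
    · rw [hnrm, hnrm, norm_inv, inv_pow, ← mul_inv, ← div_eq_mul_inv]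
      have h2 := hpos u hu1 n k
      have h3 := hpos v hv1 n k
      set q : ℂ := 1 - (starRingEnd ℂ) ((((r n : ℝ) : ℂ) • u) k) * (((r n : ℝ) : ℂ) • v) k with hq
      by_cases hk : ‖u k‖ = 1
      · have hqv : q = ((1 - r n ^ 2 : ℝ) : ℂ) := by
          have : (starRingEnd ℂ) (u k) * u k = 1 := by
            rw [mul_comm, Complex.mul_conj, Complex.normSq_eq_norm_sq, hk]
            simp
          rw [hq, Pi.smul_apply, Pi.smul_apply, smul_eq_mul, smul_eq_mul, map_mul, ← heq k hk,
            Complex.conj_ofReal]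
          push_cast
          linear_combination (-(r n : ℂ) ^ 2) * this
        have hck : c k = 1 := if_pos hk
        rw [hqv, hck, (hset k).1 hk, hk, Complex.norm_real,
          Real.norm_of_nonneg (by linarith [hr2 n])]
        apply le_of_eq
        ring
      · have hck : c k = (1 - ‖u k‖ ^ 2) * (1 - ‖v k‖ ^ 2) / 4 := if_neg hk
        have hprod : ‖(starRingEnd ℂ) ((((r n : ℝ) : ℂ) • u) k) * (((r n : ℝ) : ℂ) • v) k‖ < 1 := by
          rw [norm_mul, RCLike.norm_conj]
          exact mul_lt_one_of_nonneg_of_lt_one_left (norm_nonneg _) (hmem u hu1 n k)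
            (hmem v hv1 n k).le
        have hq0 : 0 < ‖q‖ := norm_pos_iff.2 fun h0 => by
          rw [← sub_eq_zero.1 h0, norm_one] at hprod
          exact lt_irrefl _ hprod
        have hq2 : ‖q‖ ≤ 2 := by
          refine (norm_sub_le _ _).trans ?_
          rw [norm_one]
          linarith
        have hq4 : ‖q‖ ^ 2 ≤ 4 := by nlinarith
        have h4 := hlt u hu1 k hk
        have h5 := hlt v hv1 k fun h => hk ((hset k).2 h)
        have h6 : r n ^ 2 * ‖u k‖ ^ 2 ≤ ‖u k‖ ^ 2 :=
          mul_le_of_le_one_left (sq_nonneg _) (hr2 n).le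
        have h7 : r n ^ 2 * ‖v k‖ ^ 2 ≤ ‖v k‖ ^ 2 :=
          mul_le_of_le_one_left (sq_nonneg _) (hr2 n).le
        calc c k / ((1 - r n ^ 2 * ‖v k‖ ^ 2) * (1 - r n ^ 2 * ‖u k‖ ^ 2)) ≤ 4⁻¹ := by
              rw [div_le_iff₀ (by positivity), hck]
              have : (1 - ‖u k‖ ^ 2) * (1 - ‖v k‖ ^ 2) ≤
                  (1 - r n ^ 2 * ‖u k‖ ^ 2) * (1 - r n ^ 2 * ‖v k‖ ^ 2) := by gcongr
              linarith
          _ ≤ (‖q‖ ^ 2)⁻¹ := by gcongr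

end Quotient

/-! ### Algebraic functions: branches of roots and primitive elements -/

section Branch

open Polynomial

theorem contDiff_evalEval (g : Polynomial (Polynomial ℂ)) {n : WithTop ℕ∞} :
    ContDiff ℂ n fun p : ℂ × ℂ => evalEval p.1 p.2 g := by
  have h : (fun p : ℂ × ℂ => evalEval p.1 p.2 g) =
      fun p => ∑ i ∈ g.support, (g.coeff i).aeval p.1 * p.2 ^ i := by
    funext p
    rw [← map_evalRingHom_eval, eval_map, eval₂_eq_sum, Polynomial.sum]
    rfl
  rw [h]
  refine ContDiff.sum fun i _ => ContDiff.mul ?_ (contDiff_snd.pow i)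
  exact ((g.coeff i).contDiff_aeval n).comp contDiff_fst

/-- A simple root of a polynomial with polynomial coefficients extends to a holomorphic branch of
roots. -/
theorem exists_branch {g : Polynomial (Polynomial ℂ)} {t₀ y₀ : ℂ} (h0 : evalEval t₀ y₀ g = 0)
    (h1 : evalEval t₀ y₀ (derivative g) ≠ 0) :
    ∃ s : ℂ → ℂ, (∀ᶠ t in 𝓝 t₀, DifferentiableAt ℂ s t) ∧
      ∀ᶠ t in 𝓝 t₀, evalEval t (s t) g = 0 := by
  set f : ℂ × ℂ → ℂ := fun p => evalEval p.1 p.2 g with hf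
  have cdf : ContDiffAt ℂ 1 f (t₀, y₀) := (contDiff_evalEval g).contDiffAt
  have hd : (fderiv ℂ f (t₀, y₀) ∘L .inr ℂ ℂ ℂ) 1 = evalEval t₀ y₀ (derivative g) := by
    have e1 : HasDerivAt (fun y => (t₀, y)) ((0 : ℂ), (1 : ℂ)) y₀ :=
      (hasDerivAt_const y₀ t₀).prodMk (hasDerivAt_id y₀)
    have e2 : HasDerivAt (fun y => f (t₀, y)) (fderiv ℂ f (t₀, y₀) (0, 1)) y₀ :=
      HasFDerivAt.comp_hasDerivAt (f := fun y => (t₀, y)) y₀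
        (cdf.differentiableAt one_ne_zero).hasFDerivAt e1
    have e3 := (g.map (evalRingHom t₀)).hasDerivAt y₀
    rw [derivative_map] at e3
    simp only [map_evalRingHom_eval] at e3
    exact e2.unique e3
  have if₂ : (fderiv ℂ f (t₀, y₀) ∘L .inr ℂ ℂ ℂ).IsInvertible := by
    refine ⟨ContinuousLinearEquiv.unitsEquivAut ℂ (Units.mk0 _ h1), ?_⟩
    ext
    rw [hd]
    simp
  refine ⟨cdf.implicitFunction one_ne_zero if₂, ?_, ?_⟩
  · have := (cdf.contDiffAt_implicitFunction one_ne_zero if₂).eventually (by simp)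
    exact this.mono fun t ht => ht.differentiableAt one_ne_zero
  · have := cdf.eventually_apply_implicitFunction one_ne_zero if₂
    simpa [hf, h0] using this

end Branch

section Field

open Polynomial

/-- A finitely generated algebra over a domain `R` which contains `R` has a quotient of its generic
fibre that is a finite field extension of the field of fractions of `R`. -/
theorem exists_finite_field_extension (R A : Type) [CommRing R] [IsDomain R] [CommRing A]
    [Algebra R A] [Algebra.FiniteType R A] (hinj : Function.Injective (algebraMap R A)) :
    ∃ (L : Type) (_ : Field L) (_ : Algebra R L) (_ : Algebra (FractionRing R) L)
      (_ : IsScalarTower R (FractionRing R) L), Module.Finite (FractionRing R) L ∧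
      Nonempty (A →ₐ[R] L) := by
  have : Nontrivial (TensorProduct R (FractionRing R) A) :=
    Algebra.TensorProduct.nontrivial_of_algebraMap_injective_of_flat_left _ _ _ hinj
  -- Zariski's lemma applies to the residue field of a closed point of the generic fibre
  obtain ⟨m, hm⟩ := Ideal.exists_maximal (TensorProduct R (FractionRing R) A)
  let _ : Field (TensorProduct R (FractionRing R) A ⧸ m) := Ideal.Quotient.field m
  have hfin : Module.Finite (FractionRing R) (TensorProduct R (FractionRing R) A ⧸ m) :=
    finite_of_finite_type_of_isJacobsonRing _ _
  exact ⟨TensorProduct R (FractionRing R) A ⧸ m, inferInstance, inferInstance, inferInstance,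
    inferInstance, hfin, ⟨(Ideal.Quotient.mkₐ R m).comp Algebra.TensorProduct.includeRight⟩⟩

/-- Finitely many elements of a finite extension of `ℂ(t)` are, up to a common denominator,
polynomials over `ℂ[t]` in one integral primitive element. -/
theorem exists_primitive_integral {ι L : Type} [Finite ι] [Field L] [Algebra ℂ[X] L]
    [Algebra (FractionRing ℂ[X]) L] [IsScalarTower ℂ[X] (FractionRing ℂ[X]) L]
    [Module.Finite (FractionRing ℂ[X]) L] (y : ι → L) :
    ∃ (θ : L) (D : ℂ[X]) (H : ι → Polynomial ℂ[X]), IsIntegral ℂ[X] θ ∧ D ≠ 0 ∧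
      ∀ i, aeval θ (H i) = algebraMap ℂ[X] L D * y i := by
  have := Fintype.ofFinite ι
  have : CharZero (FractionRing ℂ[X]) :=
    charZero_of_injective_algebraMap (algebraMap ℂ (FractionRing ℂ[X])).injective
  obtain ⟨θ₀, hθ₀⟩ := Field.exists_primitive_element (FractionRing ℂ[X]) L
  have halg : IsAlgebraic ℂ[X] θ₀ :=
    (IsFractionRing.isAlgebraic_iff ℂ[X] (FractionRing ℂ[X]) L).2
      (Algebra.IsAlgebraic.isAlgebraic θ₀)
  obtain ⟨c, hc0, hc⟩ := halg.exists_integral_multiple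
  have hc0' : algebraMap ℂ[X] (FractionRing ℂ[X]) c ≠ 0 := by
    simpa using hc0
  set θ : L := c • θ₀ with hθ
  have hθ₀' : θ₀ = (algebraMap ℂ[X] (FractionRing ℂ[X]) c)⁻¹ • θ := by
    rw [hθ, ← algebraMap_smul (FractionRing ℂ[X]) c θ₀, smul_smul, inv_mul_cancel₀ hc0', one_smul]
  have hgen : ∀ x : L, ∃ p : Polynomial (FractionRing ℂ[X]), aeval θ p = x := by
    intro x
    have hx : x ∈ Algebra.adjoin (FractionRing ℂ[X]) {θ₀} := by
      rw [← IntermediateField.adjoin_simple_toSubalgebra_of_isAlgebraic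
        (Algebra.IsAlgebraic.isAlgebraic θ₀), hθ₀]
      trivial
    have hle : Algebra.adjoin (FractionRing ℂ[X]) {θ₀} ≤
        Algebra.adjoin (FractionRing ℂ[X]) {θ} := by
      refine Algebra.adjoin_le ?_
      rintro _ rfl
      rw [hθ₀']
      exact Subalgebra.smul_mem _ (Algebra.self_mem_adjoin_singleton _ _) _
    have := hle hx
    rw [Algebra.adjoin_singleton_eq_range_aeval] at this
    exact this
  choose p hp using fun i => hgen (y i)
  choose b hbM hb using fun i =>
    IsLocalization.integerNormalization_spec (nonZeroDivisors ℂ[X]) (p i)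
  classical
  refine ⟨θ, ∏ i, b i, fun i => C (∏ j ∈ Finset.univ.erase i, b j) *
    IsLocalization.integerNormalization (nonZeroDivisors ℂ[X]) (p i), hc,
    Finset.prod_ne_zero_iff.2 fun i _ => nonZeroDivisors.ne_zero (hbM i), fun i => ?_⟩
  have h1 : aeval θ (IsLocalization.integerNormalization (nonZeroDivisors ℂ[X]) (p i)) =
      algebraMap ℂ[X] L (b i) * y i := by
    rw [← aeval_map_algebraMap (FractionRing ℂ[X]), hb, ← hp i,
      ← algebraMap_smul (FractionRing ℂ[X]), map_smul, Algebra.smul_def,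
      ← IsScalarTower.algebraMap_apply]
  rw [map_mul, aeval_C, h1, ← mul_assoc, ← map_mul, Finset.prod_erase_mul _ _ (Finset.mem_univ i)]

/-- Over all but finitely many parameters, the roots of the minimal polynomial of an integral
element are simple: away from the zeros of `c`, the polynomial and its derivative have no common
root. -/
theorem exists_bezout_minpoly {L : Type} [Field L] [Algebra ℂ[X] L]
    [Algebra (FractionRing ℂ[X]) L] [IsScalarTower ℂ[X] (FractionRing ℂ[X]) L]
    {θ : L} (hθ : IsIntegral ℂ[X] θ) :
    ∃ (c : ℂ[X]) (A B : Polynomial ℂ[X]), c ≠ 0 ∧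
      A * minpoly ℂ[X] θ + B * derivative (minpoly ℂ[X] θ) = C c := by
  have : CharZero (FractionRing ℂ[X]) :=
    charZero_of_injective_algebraMap (algebraMap ℂ (FractionRing ℂ[X])).injective
  have hirr : Irreducible (minpoly (FractionRing ℂ[X]) θ) := minpoly.irreducible hθ.tower_top
  obtain ⟨a, b, hab⟩ := hirr.separable
  rw [minpoly.isIntegrallyClosed_eq_field_fractions' (FractionRing ℂ[X]) hθ] at hab
  obtain ⟨m, hmM, hm⟩ := IsLocalization.integerNormalization_spec (nonZeroDivisors ℂ[X]) a
  obtain ⟨n, hnM, hn⟩ := IsLocalization.integerNormalization_spec (nonZeroDivisors ℂ[X]) b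
  refine ⟨m * n, C n * IsLocalization.integerNormalization (nonZeroDivisors ℂ[X]) a,
    C m * IsLocalization.integerNormalization (nonZeroDivisors ℂ[X]) b,
    mul_ne_zero (nonZeroDivisors.ne_zero hmM) (nonZeroDivisors.ne_zero hnM), ?_⟩
  refine map_injective (algebraMap ℂ[X] (FractionRing ℂ[X])) (IsFractionRing.injective _ _) ?_
  have hs : ∀ (k : ℂ[X]) (q : Polynomial (FractionRing ℂ[X])),
      k • q = C (algebraMap ℂ[X] (FractionRing ℂ[X]) k) * q := fun k q => by
    rw [← algebraMap_smul (FractionRing ℂ[X]), smul_eq_C_mul]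
  simp only [Polynomial.map_add, Polynomial.map_mul, map_C, hm, hn, hs, map_mul,
    derivative_map] at hab ⊢
  linear_combination (C (algebraMap ℂ[X] (FractionRing ℂ[X]) m) *
    C (algebraMap ℂ[X] (FractionRing ℂ[X]) n)) * hab

end Field

/-! ### Holomorphic curves in the variety of a homogeneous ideal -/

section Cone

open MvPolynomial

theorem aeval_const_mul_of_isHomogeneous {σ R S : Type*} [Fintype σ] [CommSemiring R]
    [CommSemiring S] [Algebra R S] {p : MvPolynomial σ R} {n : ℕ} (hp : p.IsHomogeneous n) (c : S)
    (z : σ → S) : aeval (fun i => c * z i) p = c ^ n * aeval z p := by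
  rw [aeval_def, eval₂_eq', aeval_def, eval₂_eq', Finset.mul_sum]
  refine Finset.sum_congr rfl fun α hα => ?_
  have h : ∑ i, α i = n := by
    have := hp (mem_support_iff.1 hα)
    change Finsupp.weight (fun _ => 1) α = n at this
    rwa [← Finsupp.degree_eq_weight_one, Finsupp.degree_eq_sum] at this
  rw [← h, ← Finset.prod_pow_eq_pow_sum]
  simp_rw [mul_pow, Finset.prod_mul_distrib]
  ring

variable {d : ℕ} {I : Ideal (MvPolynomial (Fin d) ℂ)}

/-- Membership in the zero variety of a homogeneous ideal may be tested on homogeneous elements. -/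
theorem mem_zeroLocus_of_homogeneous (hI : I.IsHomogeneous (homogeneousSubmodule (Fin d) ℂ))
    {z : Fin d → ℂ} (h : ∀ n, ∀ p ∈ I, p.IsHomogeneous n → aeval z p = 0) : z ∈ zeroLocus ℂ I := by
  intro p hp
  rw [← sum_homogeneousComponent p, map_sum]
  refine Finset.sum_eq_zero fun n _ => h n _ ?_ (homogeneousComponent_isHomogeneous n p)
  have := hI n hp
  rwa [← decomposition.decompose'_apply]

theorem smul_mem_zeroLocus (hI : I.IsHomogeneous (homogeneousSubmodule (Fin d) ℂ))
    {z : Fin d → ℂ} (hz : z ∈ zeroLocus ℂ I) (c : ℂ) : c • z ∈ zeroLocus ℂ I := by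
  refine mem_zeroLocus_of_homogeneous hI fun n p hp hn => ?_
  have := aeval_const_mul_of_isHomogeneous hn c z
  rw [hz p hp, mul_zero] at this
  exact this

open Polynomial in
/-- If the function `z_k / z_j` takes infinitely many values on the zero variety of a homogeneous
ideal, the variety contains a holomorphic curve on which `z_k / z_j` is the parameter. -/
theorem exists_holomorphic_curve (hI : I.IsHomogeneous (homogeneousSubmodule (Fin d) ℂ))
    (j k : Fin d) (hinf : {w | ∃ z ∈ zeroLocus ℂ I, z j = 1 ∧ z k = w}.Infinite) :
    ∃ (t₀ : ℂ) (γ : ℂ → Fin d → ℂ), (∀ᶠ t in 𝓝 t₀, DifferentiableAt ℂ γ t) ∧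
      ∀ᶠ t in 𝓝 t₀, γ t ∈ zeroLocus ℂ I ∧ γ t j ≠ 0 ∧ γ t k = t * γ t j := by
  set J : Ideal (MvPolynomial (Fin d) ℂ) := I ⊔ Ideal.span {MvPolynomial.X j - 1} with hJ
  let A := MvPolynomial (Fin d) ℂ ⧸ J
  let x : Fin d → A := fun i => Ideal.Quotient.mk J (MvPolynomial.X i)
  -- `ℂ[X]` acts on the coordinate ring of `Z ∩ {z_j = 1}` through the coordinate `z_k`
  let _ : Algebra ℂ[X] A := (Polynomial.aeval (R := ℂ) (x k)).toRingHom.toAlgebra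
  have hmap : ∀ p : ℂ[X], algebraMap ℂ[X] A p = Polynomial.aeval (x k) p := fun _ => rfl
  have : IsScalarTower ℂ ℂ[X] A := IsScalarTower.of_algebraMap_eq fun c => by
    rw [hmap, Polynomial.algebraMap_eq, Polynomial.aeval_C]
  have : Algebra.FiniteType ℂ[X] A := Algebra.FiniteType.of_restrictScalars_finiteType ℂ ℂ[X] A
  have hinj : Function.Injective (algebraMap ℂ[X] A) := by
    rw [injective_iff_map_eq_zero]
    intro p hp
    have h1 : Polynomial.aeval (MvPolynomial.X k : MvPolynomial (Fin d) ℂ) p ∈ J := by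
      rw [← Ideal.Quotient.eq_zero_iff_mem, ← hp, hmap]
      exact (Polynomial.aeval_algHom_apply (Ideal.Quotient.mkₐ ℂ J) _ p).symm
    refine Polynomial.eq_zero_of_infinite_isRoot p (hinf.mono ?_)
    rintro _ ⟨z, hz, hzj, rfl⟩
    have hle : J ≤ RingHom.ker (MvPolynomial.aeval (R := ℂ) z) := by
      refine sup_le (fun q hq => hz q hq) ?_
      rw [Ideal.span_singleton_le_iff_mem, RingHom.mem_ker]
      simp [hzj]
    have h2 : MvPolynomial.aeval z (Polynomial.aeval (MvPolynomial.X k) p) = 0 := hle h1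
    rw [← Polynomial.aeval_algHom_apply, MvPolynomial.aeval_X] at h2
    simpa [Polynomial.IsRoot] using h2
  obtain ⟨L, _, _, _, _, hfin, ⟨φ⟩⟩ := exists_finite_field_extension ℂ[X] A hinj
  let y : Fin d → L := fun i => φ (x i)
  let _ : Algebra ℂ L := ((algebraMap ℂ[X] L).comp Polynomial.C).toAlgebra
  have : IsScalarTower ℂ ℂ[X] L := IsScalarTower.of_algebraMap_eq fun _ => rfl
  have hy : ∀ p, MvPolynomial.aeval y p = φ (Ideal.Quotient.mk J p) := by
    intro p
    have : MvPolynomial.aeval y = (φ.restrictScalars ℂ).comp (Ideal.Quotient.mkₐ ℂ J) :=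
      MvPolynomial.algHom_ext fun i => (MvPolynomial.aeval_X y i).trans rfl
    rw [this]
    rfl
  have hyI : ∀ p ∈ I, MvPolynomial.aeval y p = 0 := fun p hp => by
    rw [hy, Ideal.Quotient.eq_zero_iff_mem.2 (le_sup_left (a := I) hp), map_zero]
  have hyj : y j = 1 := by
    have h1 : Ideal.Quotient.mk J (MvPolynomial.X j) = 1 := by
      rw [← map_one (Ideal.Quotient.mk J), Ideal.Quotient.eq]
      exact le_sup_right (a := I) (Ideal.mem_span_singleton_self _)
    simp only [y, x, h1, map_one]
  have hyk : y k = algebraMap ℂ[X] L Polynomial.X := by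
    have : x k = algebraMap ℂ[X] A Polynomial.X := by rw [hmap, Polynomial.aeval_X]
    simp only [y, this, AlgHom.commutes]
  obtain ⟨θ, D, H, hθ, hD, hH⟩ := exists_primitive_integral y
  obtain ⟨c, a, b, hc, hab⟩ := exists_bezout_minpoly hθ
  set g := minpoly ℂ[X] θ with hg
  have : Module.IsTorsionFree ℂ[X] L := by
    rw [Module.isTorsionFree_iff_algebraMap_injective]
    rw [IsScalarTower.algebraMap_eq ℂ[X] (FractionRing ℂ[X]) L]
    exact (algebraMap (FractionRing ℂ[X]) L).injective.comp (IsFractionRing.injective _ _)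
  -- a parameter at which the curve is unramified and the denominator does not vanish
  obtain ⟨t₀, ht₀⟩ : ∃ t₀, (c * D).eval t₀ ≠ 0 := by
    by_contra! h
    exact mul_ne_zero hc hD (Polynomial.funext fun t => by simpa using h t)
  rw [Polynomial.eval_mul] at ht₀
  obtain ⟨y₀, hy₀⟩ : ∃ y₀, evalEval t₀ y₀ g = 0 := by
    have hmonic : g.Monic := minpoly.monic hθ
    have hdeg : (g.map (evalRingHom t₀)).degree ≠ 0 := by
      rw [hmonic.degree_map]
      exact (minpoly.degree_pos hθ).ne'
    obtain ⟨y₀, h⟩ := IsAlgClosed.exists_root _ hdeg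
    exact ⟨y₀, by rwa [Polynomial.IsRoot, map_evalRingHom_eval] at h⟩
  have hder : evalEval t₀ y₀ (derivative g) ≠ 0 := by
    intro h
    have := congrArg (evalEval t₀ y₀) hab
    rw [evalEval_add, evalEval_mul, evalEval_mul, h, hy₀, evalEval_C] at this
    exact left_ne_zero_of_mul ht₀ (by simpa using this.symm)
  obtain ⟨s, hs, hroot⟩ := exists_branch hy₀ hder
  -- the denominator `D` only rescales the point, so it may be dropped in the cone `Z`
  refine ⟨t₀, fun t i => evalEval t (s t) (H i), ?_, ?_⟩
  · filter_upwards [hs] with t ht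
    rw [differentiableAt_pi]
    intro i
    exact ((contDiff_evalEval (H i) (n := 1)).differentiable one_ne_zero (t, s t)).comp t
      (differentiableAt_id.prodMk ht)
  · have hDt : ∀ᶠ t in 𝓝 t₀, D.eval t ≠ 0 :=
      D.continuous.continuousAt.eventually_ne (right_ne_zero_of_mul ht₀)
    filter_upwards [hroot, hDt] with t ht hDt
    -- polynomial relations that hold for the primitive element persist on the branch of roots
    have hker : ∀ P : Polynomial ℂ[X], Polynomial.aeval θ P = 0 → evalEval t (s t) P = 0 := by
      intro P hP
      have := evalEval_dvd t (s t) (minpoly.isIntegrallyClosed_dvd hθ hP)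
      rw [← hg, ht] at this
      exact zero_dvd_iff.1 this
    have h1 : evalEval t (s t) (H j) = D.eval t := by
      have := hker (H j - Polynomial.C D) (by
        rw [map_sub, hH, hyj, Polynomial.aeval_C, mul_one, sub_self])
      rwa [evalEval_sub, evalEval_C, sub_eq_zero] at this
    have h2 : evalEval t (s t) (H k) = t * D.eval t := by
      have := hker (H k - Polynomial.C (Polynomial.X * D)) (by
        rw [map_sub, hH, hyk, Polynomial.aeval_C, map_mul, mul_comm, sub_self])
      rw [evalEval_sub, evalEval_C, sub_eq_zero] at this
      simpa using this
    refine ⟨mem_zeroLocus_of_homogeneous hI fun n p hp hn => ?_, by rwa [h1], by rw [h1, h2]⟩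
    have h3 : Polynomial.aeval θ (MvPolynomial.aeval H p) = 0 := by
      have e : (Polynomial.aeval θ).restrictScalars ℂ (MvPolynomial.aeval H p) =
          MvPolynomial.aeval (fun i => algebraMap ℂ[X] L D * y i) p := by
        rw [MvPolynomial.comp_aeval_apply]
        simp [hH]
      rw [aeval_const_mul_of_isHomogeneous hn, hyI p hp, mul_zero] at e
      exact e
    have h4 := hker _ h3
    rw [← coe_aevalAeval_eq_evalEval] at h4 ⊢
    rw [← h4, MvPolynomial.comp_aeval_apply]

end Cone

/-! ### Finiteness of the number of lines -/

open MvPolynomial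

section Lines

variable {d : ℕ} {I : Ideal (MvPolynomial (Fin d) ℂ)}

/-- On a holomorphic curve in the variety, the coordinates of largest modulus have, near a suitable
point, constant ratios by the maximum principle, so essential normality makes the curve
projectively constant. -/
theorem EssentiallyNormal.finite_ratio (hN : EssentiallyNormal (closureIdeal I)ᗮ)
    (hI : I.IsHomogeneous (homogeneousSubmodule (Fin d) ℂ)) (j k : Fin d) :
    {w | ∃ z ∈ zeroLocus ℂ I, z j = 1 ∧ z k = w}.Finite := by
  classical
  by_contra hinf
  obtain ⟨t₀, γ, hd, hγ⟩ := exists_holomorphic_curve hI j k hinf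
  let Λ : ℂ → Finset (Fin d) := fun t => Finset.univ.filter fun i => ‖γ t i‖ = ‖γ t‖
  let G : Set ℂ := {t | ∀ᶠ t' in 𝓝 t, DifferentiableAt ℂ γ t' ∧
    γ t' ∈ zeroLocus ℂ I ∧ γ t' j ≠ 0 ∧ γ t' k = t' * γ t' j}
  -- a point where the number of coordinates of largest modulus is minimal
  obtain ⟨t₁, ht₁, hmin⟩ := (measure fun t => (Λ t).card).wf.has_min G ⟨t₀, hd.and hγ⟩
  have hpos : ∀ {t}, γ t j ≠ 0 → 0 < ‖γ t‖ := fun {t} h =>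
    (norm_pos_iff.2 h).trans_le (norm_le_pi_norm (γ t) j)
  have hcont : ContinuousAt γ t₁ := ht₁.self_of_nhds.1.continuousAt
  have hsub : ∀ᶠ t in 𝓝 t₁, Λ t ⊆ Λ t₁ := by
    have h1 : ∀ i, ∀ᶠ t in 𝓝 t₁, i ∈ Λ t → i ∈ Λ t₁ := by
      intro i
      by_cases hi : i ∈ Λ t₁
      · exact Eventually.of_forall fun _ _ => hi
      · have hlt : ‖γ t₁ i‖ < ‖γ t₁‖ :=
          lt_of_le_of_ne (norm_le_pi_norm _ i) fun h => hi (by simp [Λ, h])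
        have hci : ContinuousAt (fun t => ‖γ t i‖) t₁ :=
          ((continuous_apply i).continuousAt.comp hcont).norm
        filter_upwards [hci.eventually_lt hcont.norm hlt] with t ht hit
        simp only [Λ, Finset.mem_filter, Finset.mem_univ, true_and] at hit
        exact absurd hit ht.ne
    filter_upwards [eventually_all.2 h1] with t ht i hi using ht i hi
  have hΛ : ∀ᶠ t in 𝓝 t₁, Λ t = Λ t₁ := by
    filter_upwards [hsub, eventually_eventually_nhds.2 ht₁] with t h1 h2
    exact Finset.eq_of_subset_of_card_le h1 (not_lt.1 (hmin t h2))
  obtain ⟨i₀, hi₀⟩ : ∃ i, i ∈ Λ t₁ := by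
    by_contra! hne
    have := (pi_norm_lt_iff (hpos ht₁.self_of_nhds.2.2.1)).2 fun i =>
      lt_of_le_of_ne (norm_le_pi_norm (γ t₁) i) fun h => hne i (by simp [Λ, h])
    exact lt_irrefl _ this
  let u : ℂ → Fin d → ℂ := fun t => (γ t i₀)⁻¹ • γ t
  have hi₀' : ∀ᶠ t in 𝓝 t₁, ‖γ t i₀‖ = ‖γ t‖ ∧ 0 < ‖γ t‖ := by
    filter_upwards [hΛ, ht₁] with t h1 h2
    have : i₀ ∈ Λ t := h1 ▸ hi₀
    exact ⟨(Finset.mem_filter.1 this).2, hpos h2.2.2.1⟩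
  have hun : ∀ᶠ t in 𝓝 t₁, ‖u t‖ = 1 ∧ ∀ i, ‖u t i‖ = 1 ↔ i ∈ Λ t₁ := by
    filter_upwards [hi₀', hΛ] with t h1 h2
    have hne : ‖γ t‖ ≠ 0 := h1.2.ne'
    refine ⟨by rw [norm_smul, norm_inv, h1.1, inv_mul_cancel₀ hne], fun i => ?_⟩
    have hui : u t i = (γ t i₀)⁻¹ * γ t i := rfl
    rw [← h2, hui, norm_mul, norm_inv, h1.1, inv_mul_eq_one₀ hne]
    simp [Λ, eq_comm]
  have hu : ∀ᶠ t in 𝓝 t₁, DifferentiableAt ℂ u t := by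
    filter_upwards [hi₀', ht₁] with t h1 h2
    have h3 : γ t i₀ ≠ 0 := norm_pos_iff.1 (h1.1 ▸ h1.2)
    exact ((differentiableAt_pi.1 h2.1 i₀).inv h3).smul h2.1
  have hconst : ∀ i, ∀ᶠ t in 𝓝 t₁, i ∈ Λ t₁ → u t i = u t₁ i := by
    intro i
    by_cases hi : i ∈ Λ t₁
    · have hmax : IsLocalMax (norm ∘ fun t => u t i) t₁ := by
        filter_upwards [hun] with t ht
        exact (((ht.2 i).2 hi).trans ((hun.self_of_nhds.2 i).2 hi).symm).le
      have := Complex.eventually_eq_of_isLocalMax_norm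
        (hu.mono fun t ht => differentiableAt_pi.1 ht i) hmax
      exact this.mono fun t ht _ => ht
    · exact Eventually.of_forall fun _ h => absurd h hi
  have heq : ∀ᶠ t in 𝓝 t₁, t = t₁ := by
    filter_upwards [ht₁, hun, eventually_all.2 hconst, hi₀'] with t h1 h2 h3 h4
    have h5 := hun.self_of_nhds
    have h6 := ht₁.self_of_nhds
    have key : u t = u t₁ := hN.eq_of_unimodular_eq (fun z hz c => smul_mem_zeroLocus hI hz c)
      (smul_mem_zeroLocus hI h1.2.1 _) (smul_mem_zeroLocus hI h6.2.1 _) h2.1 h5.1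
      (fun i => (h2.2 i).trans (h5.2 i).symm) fun i hi => h3 i ((h2.2 i).1 hi)
    have e1 : u t k = t * u t j := by
      simp only [u, Pi.smul_apply, smul_eq_mul, h1.2.2.2]
      ring
    have e2 : u t₁ k = t₁ * u t₁ j := by
      simp only [u, Pi.smul_apply, smul_eq_mul, h6.2.2.2]
      ring
    have hne : u t₁ j ≠ 0 := by
      rw [← key]
      have h7 : γ t i₀ ≠ 0 := norm_pos_iff.1 (h4.1 ▸ h4.2)
      exact mul_ne_zero (inv_ne_zero h7) h1.2.2.1
    rw [key, e2] at e1
    exact (mul_right_cancel₀ hne e1).symm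
  obtain ⟨t, ht, hne⟩ := ((heq.filter_mono nhdsWithin_le_nhds).and
    (self_mem_nhdsWithin : {t₁}ᶜ ∈ 𝓝[≠] t₁)).exists
  exact hne ht

/-- If the quotient module is essentially normal, the variety is a finite union of lines through
the origin. -/
theorem EssentiallyNormal.exists_finset_lines (hN : EssentiallyNormal (closureIdeal I)ᗮ)
    (hI : I.IsHomogeneous (homogeneousSubmodule (Fin d) ℂ)) :
    ∃ E : Finset (Fin d → ℂ), ∀ z ∈ zeroLocus ℂ I, z ≠ 0 → ∃ e ∈ E, ∃ c : ℂ, z = c • e := by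
  have hfin : (⋃ j, {z | z ∈ zeroLocus ℂ I ∧ z j = 1}).Finite := by
    refine Set.finite_iUnion fun j => ?_
    refine (Set.Finite.pi' fun k => hN.finite_ratio hI j k).subset fun z hz k => ?_
    exact ⟨z, hz.1, hz.2, rfl⟩
  refine ⟨hfin.toFinset, fun z hz hz0 => ?_⟩
  obtain ⟨j, hj⟩ := Function.ne_iff.1 hz0
  refine ⟨(z j)⁻¹ • z, ?_, z j, (smul_inv_smul₀ hj z).symm⟩
  rw [Set.Finite.mem_toFinset, Set.mem_iUnion]
  exact ⟨j, smul_mem_zeroLocus hI hz _, inv_mul_cancel₀ hj⟩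

end Lines

/-! ### Dimension of the variety and of the quotient module -/

section Dimension

/-- A chain of three primes cannot contain the kernel of a surjection onto a principal ideal
domain. -/
theorem not_ker_le_of_lt_of_lt {R S : Type*} [CommRing R] [CommRing S] [IsDomain S]
    [IsPrincipalIdealRing S] {π : R →+* S} (hπ : Function.Surjective π) {P₀ P₁ P₂ : Ideal R}
    [P₁.IsPrime] [P₂.IsPrime] (h₀ : P₀ < P₁) (h₁ : P₁ < P₂) : ¬ RingHom.ker π ≤ P₀ := by
  intro hker
  have hk₁ := hker.trans h₀.le
  have hk₂ := hk₁.trans h₁.le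
  have := Ideal.map_isPrime_of_surjective hπ hk₁
  have := Ideal.map_isPrime_of_surjective hπ hk₂
  obtain ⟨x, hx, hx'⟩ := Set.exists_of_ssubset h₀
  have hne : P₁.map π ≠ ⊥ := fun h => by
    have := Ideal.mem_map_of_mem π hx
    rw [h, Ideal.mem_bot] at this
    exact hx' (hker this)
  have hmax := IsPrime.to_maximal_ideal hne
  have heq := hmax.eq_of_le (Ideal.IsPrime.ne_top inferInstance) (Ideal.map_mono (f := π) h₁.le)
  obtain ⟨w, hw, hw'⟩ := Set.exists_of_ssubset h₁
  have h2 := Ideal.mem_map_of_mem π hw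
  rw [← heq] at h2
  obtain ⟨v, hv, hvw⟩ := (Ideal.mem_map_iff_of_surjective π hπ).1 h2
  refine hw' ?_
  have h3 : w - v ∈ P₁ := hk₁ (by rw [RingHom.mem_ker, map_sub, hvw, sub_self])
  simpa using P₁.add_mem h3 hv

/-- The vanishing ideal of a line (or of the origin) has no chain of three primes above it. -/
theorem not_vanishingIdeal_line_le {d : ℕ} (e : Fin d → ℂ)
    {P₀ P₁ P₂ : Ideal (MvPolynomial (Fin d) ℂ)} [P₁.IsPrime] [P₂.IsPrime] (h₀ : P₀ < P₁)
    (h₁ : P₁ < P₂) : ¬ vanishingIdeal ℂ {z | ∃ c : ℂ, z = c • e} ≤ P₀ := by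
  intro hle
  by_cases he : e = 0
  · have hsurj : Function.Surjective (aeval (R := ℂ) (0 : Fin d → ℂ)).toRingHom := fun c =>
      ⟨C c, by simp⟩
    refine not_ker_le_of_lt_of_lt hsurj h₀ h₁ (le_trans ?_ hle)
    rintro p hp _ ⟨c, rfl⟩
    rw [he, smul_zero]
    exact hp
  · obtain ⟨i, hi⟩ := Function.ne_iff.1 he
    let π : MvPolynomial (Fin d) ℂ →ₐ[ℂ] Polynomial ℂ :=
      aeval fun i => Polynomial.C (e i) * Polynomial.X
    have hsurj : Function.Surjective π.toRingHom := by
      intro q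
      refine ⟨Polynomial.aeval (C (e i)⁻¹ * X i) q, ?_⟩
      change π _ = q
      rw [← Polynomial.aeval_algHom_apply]
      have : π (C (e i)⁻¹ * X i) = Polynomial.X := by
        simp only [π, map_mul, aeval_X, aeval_C, Polynomial.algebraMap_eq]
        rw [← mul_assoc, ← Polynomial.C_mul, inv_mul_cancel₀ hi, Polynomial.C_1, one_mul]
      rw [this, Polynomial.aeval_X_left_apply]
    refine not_ker_le_of_lt_of_lt hsurj h₀ h₁ (le_trans ?_ hle)
    rintro p hp _ ⟨c, rfl⟩
    have h1 : π p = 0 := hp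
    have h2 : Polynomial.aeval c (π p) = aeval (c • e) p := by
      rw [comp_aeval_apply]
      congr 2
      funext i
      rw [map_mul, Polynomial.aeval_C, Polynomial.aeval_X, mul_comm]
      rfl
    rw [← h2, h1, map_zero]

/-- A set contained in a finite union of lines has dimension less than two. -/
theorem not_two_le_varietyDim {d : ℕ} {Z : Set (Fin d → ℂ)} (E : Finset (Fin d → ℂ))
    (hE : ∀ z ∈ Z, ∃ e ∈ E, ∃ c : ℂ, z = c • e) : ¬ 2 ≤ varietyDim Z := by
  intro h
  rw [varietyDim, ringKrullDim] at h
  obtain ⟨l, hl⟩ := (Order.le_krullDim_iff (n := 2)).1 (by exact_mod_cast h)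
  let f := algebraMap (MvPolynomial (Fin d) ℂ) (MvPolynomial (Fin d) ℂ ⧸ vanishingIdeal ℂ Z)
  have hf : Function.Surjective f := Ideal.Quotient.mk_surjective
  let P : Fin (l.length + 1) → Ideal (MvPolynomial (Fin d) ℂ) := fun i => (l i).asIdeal.comap f
  have hP : StrictMono P := fun a b hab =>
    lt_of_le_of_ne (Ideal.comap_mono (l.strictMono hab).le) fun h =>
      (l.strictMono hab).ne (PrimeSpectrum.ext (Ideal.comap_injective_of_surjective f hf h))
  have hprime : ∀ i, (P i).IsPrime := fun i => (l i).isPrime.comap f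
  have h01 : P ⟨0, by omega⟩ < P ⟨1, by omega⟩ := hP (by simp [Fin.lt_def])
  have h12 : P ⟨1, by omega⟩ < P ⟨2, by omega⟩ := hP (by simp [Fin.lt_def])
  have hinf : E.inf (fun e => vanishingIdeal ℂ {z | ∃ c : ℂ, z = c • e}) ≤ P ⟨0, by omega⟩ := by
    intro p hp
    have h1 : p ∈ vanishingIdeal ℂ Z := by
      intro z hz
      obtain ⟨e, he, hze⟩ := hE z hz
      exact Finset.inf_le (f := fun e => vanishingIdeal ℂ {z : Fin d → ℂ | ∃ c : ℂ, z = c • e}) he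
        hp z hze
    have h2 : f p = 0 := Ideal.Quotient.eq_zero_iff_mem.2 h1
    rw [Ideal.mem_comap, h2]
    exact zero_mem _
  obtain ⟨e, -, he⟩ := (Ideal.IsPrime.inf_le' (hprime _)).1 hinf
  have := hprime ⟨1, by omega⟩
  have := hprime ⟨2, by omega⟩
  exact not_vanishingIdeal_line_le e h01 h12 he

/-- If the variety is contained in `{0}`, all monomials of high degree lie in the ideal, so the
quotient module is finite-dimensional. -/
theorem finiteDimensional_of_zeroLocus_subset {d : ℕ} {I : Ideal (MvPolynomial (Fin d) ℂ)}
    (h : ∀ z ∈ zeroLocus ℂ I, z = 0) : FiniteDimensional ℂ (closureIdeal I)ᗮ := by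
  have hX : ∀ i, ∃ m, (X i : MvPolynomial (Fin d) ℂ) ^ m ∈ I := fun i => by
    have h1 : (X i : MvPolynomial (Fin d) ℂ) ∈ vanishingIdeal ℂ (zeroLocus ℂ I) := fun z hz => by
      rw [h z hz]; simp
    rwa [vanishingIdeal_zeroLocus_eq_radical] at h1
  choose m hm using hX
  let S := {α : Fin d →₀ ℕ // ∀ i, α i < m i}
  have : Finite S := by
    refine Finite.of_injective (fun (α : S) (i : Fin d) => (⟨α.1 i, α.2 i⟩ : Fin (m i))) ?_
    intro α β hαβ
    ext i
    exact congrArg Fin.val (congrFun hαβ i)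
  let T : (closureIdeal I)ᗮ →ₗ[ℂ] (S → ℂ) :=
    { toFun := fun f α => (f : HardySpace d).coeff α
      map_add' := fun f g => by
        funext α
        simp [HardySpace.coeff_add]
      map_smul' := fun c f => by
        funext α
        simp [HardySpace.coeff_smul] }
  refine FiniteDimensional.of_injective T ((injective_iff_map_eq_zero T).2 fun f hf => ?_)
  refine Subtype.ext (HardySpace.coeff_injective ?_)
  ext α
  have h0 : ((0 : (closureIdeal I)ᗮ) : HardySpace d).coeff = 0 := (HardySpace.coeffIso d).map_zero
  rw [h0]
  by_cases hα : ∀ i, α i < m i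
  · exact congrFun hf ⟨α, hα⟩
  · push Not at hα
    obtain ⟨i, hi⟩ := hα
    have hmem : monomial α (1 : ℂ) ∈ I := by
      have e : monomial α (1 : ℂ) = monomial (α - Finsupp.single i (m i)) 1 * X i ^ m i := by
        rw [X_pow_eq_monomial, monomial_mul, one_mul, tsub_add_cancel_of_le (by simpa using hi)]
      rw [e]
      exact I.mul_mem_left _ (hm i)
    have h1 : ofPoly d (monomial α 1) ∈ closureIdeal I :=
      Submodule.le_topologicalClosure _ ⟨_, hmem, rfl⟩
    rw [← inner_ofPoly_monomial]
    exact f.2 _ h1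

end Dimension

/-! ### The discs of the variety -/

section Discs

variable {d : ℕ} {I : Ideal (MvPolynomial (Fin d) ℂ)}

theorem mem_frontier_polydisc {u : Fin d → ℂ} : u ∈ frontier (polydisc d) ↔ ‖u‖ = 1 := by
  rw [polydisc_eq_ball, frontier_ball _ one_ne_zero, mem_sphere_zero_iff_norm]

theorem mem_polydisc {u : Fin d → ℂ} : u ∈ polydisc d ↔ ‖u‖ < 1 := by
  rw [polydisc_eq_ball, mem_ball_zero_iff]

theorem disc_smul (u : Fin d → ℂ) {c : ℂ} (hc : ‖c‖ = 1) : disc (c • u) = disc u := by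
  have hc0 : c ≠ 0 := norm_pos_iff.1 (by rw [hc]; exact one_pos)
  ext z
  constructor
  · rintro ⟨l, hl, rfl⟩
    exact ⟨l * c, by rwa [norm_mul, hc, mul_one], (mul_smul _ _ _).symm⟩
  · rintro ⟨l, hl, rfl⟩
    refine ⟨l * c⁻¹, by rwa [norm_mul, norm_inv, hc, inv_one, mul_one], ?_⟩
    rw [smul_smul, mul_assoc, inv_mul_cancel₀ hc0, mul_one]

/-- Each line of the variety contributes one disc. A nonzero point of the variety is needed for the
origin to be covered. -/
theorem EssentiallyNormal.exists_isDiscDecomposition (hN : EssentiallyNormal (closureIdeal I)ᗮ)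
    (hI : I.IsHomogeneous (homogeneousSubmodule (Fin d) ℂ)) {z₀ : Fin d → ℂ}
    (hz₀ : z₀ ∈ zeroLocus ℂ I) (hz₀' : z₀ ≠ 0) :
    ∃ (n : ℕ) (u : Fin n → Fin d → ℂ), IsDiscDecomposition (zeroLocus ℂ I) u := by
  obtain ⟨E, hE⟩ := hN.exists_finset_lines hI
  set 𝒟 : Set (Set (Fin d → ℂ)) := disc '' {u | u ∈ zeroLocus ℂ I ∧ ‖u‖ = 1} with h𝒟
  have hfin : 𝒟.Finite := by
    refine (E.finite_toSet.image fun e => {w | ‖w‖ < 1 ∧ ∃ c : ℂ, w = c • e}).subset ?_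
    rintro _ ⟨u, ⟨hu, hu1⟩, rfl⟩
    have hu0 : u ≠ 0 := norm_pos_iff.1 (by rw [hu1]; exact one_pos)
    obtain ⟨e, he, c, rfl⟩ := hE u hu hu0
    have hc : c ≠ 0 := fun h => hu0 (by rw [h, zero_smul])
    refine ⟨e, he, ?_⟩
    ext w
    constructor
    · rintro ⟨hw, b, rfl⟩
      have hb : b • e = (b / c) • (c • e) := by rw [smul_smul, div_mul_cancel₀ _ hc]
      refine ⟨b / c, ?_, hb⟩
      rwa [hb, norm_smul, hu1, mul_one] at hw
    · rintro ⟨l, hl, rfl⟩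
      exact ⟨by rwa [norm_smul, hu1, mul_one], l * c, (mul_smul _ _ _).symm⟩
  have := hfin.to_subtype
  let e := (Finite.equivFin 𝒟).symm
  choose u hu hue using fun i => (e i).2
  have hsurj : ∀ v ∈ zeroLocus ℂ I, ‖v‖ = 1 → ∃ i, disc (u i) = disc v := fun v hv hv1 => by
    obtain ⟨i, hi⟩ := e.surjective ⟨disc v, v, ⟨hv, hv1⟩, rfl⟩
    exact ⟨i, by rw [hue, hi]⟩
  refine ⟨_, u, fun i => mem_frontier_polydisc.2 (hu i).2, fun i j hij h => hij ?_, ?_⟩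
  · exact e.injective (Subtype.ext (by rw [← hue, ← hue, h]))
  · have hnorm : ∀ z ∈ zeroLocus ℂ I, z ≠ 0 →
        ((‖z‖⁻¹ : ℝ) : ℂ) • z ∈ zeroLocus ℂ I ∧ ‖((‖z‖⁻¹ : ℝ) : ℂ) • z‖ = 1 := fun z hz hz0 =>
      ⟨smul_mem_zeroLocus hI hz _, by
        rw [norm_smul, Complex.norm_real, norm_inv, norm_norm,
          inv_mul_cancel₀ (norm_ne_zero_iff.2 hz0)]⟩
    ext z
    rw [Set.mem_iUnion]
    constructor
    · rintro ⟨hz, hzd⟩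
      by_cases hz0 : z = 0
      · obtain ⟨i, -⟩ := hsurj _ (hnorm z₀ hz₀ hz₀').1 (hnorm z₀ hz₀ hz₀').2
        exact ⟨i, 0, by simp, by rw [hz0, zero_smul]⟩
      · obtain ⟨i, hi⟩ := hsurj _ (hnorm z hz hz0).1 (hnorm z hz hz0).2
        refine ⟨i, hi ▸ ⟨(‖z‖ : ℂ), ?_, ?_⟩⟩
        · rw [Complex.norm_real, norm_norm]
          exact mem_polydisc.1 hzd
        · rw [smul_smul, ← Complex.ofReal_mul, mul_inv_cancel₀ (norm_ne_zero_iff.2 hz0),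
            Complex.ofReal_one, one_smul]
    · rintro ⟨i, l, hl, rfl⟩
      refine ⟨smul_mem_zeroLocus hI (hu i).1 l, mem_polydisc.2 ?_⟩
      rwa [norm_smul, (hu i).2, mul_one]

/-- Discs of the variety with the same unimodular coordinates have linearly independent vectors of
unimodular coordinates. -/
theorem EssentiallyNormal.linearIndependent (hN : EssentiallyNormal (closureIdeal I)ᗮ)
    (hI : I.IsHomogeneous (homogeneousSubmodule (Fin d) ℂ)) {n : ℕ} {u : Fin n → Fin d → ℂ}
    (hu : IsDiscDecomposition (zeroLocus ℂ I) u) {i j : Fin n} (hij : i ≠ j)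
    (hΛ : unimodularSet (u i) = unimodularSet (u j)) :
    LinearIndependent ℂ ![fun k : unimodularSet (u i) => u i k,
      fun k : unimodularSet (u i) => u j k] := by
  obtain ⟨hfr, hne, hZ⟩ := hu
  have hn : ∀ i, ‖u i‖ = 1 := fun i => mem_frontier_polydisc.1 (hfr i)
  have huZ : ∀ i, u i ∈ zeroLocus ℂ I := by
    intro i
    have h1 : (2⁻¹ : ℂ) • u i ∈ zeroLocus ℂ I ∩ polydisc d := by
      rw [hZ, Set.mem_iUnion]
      exact ⟨i, 2⁻¹, by norm_num, rfl⟩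
    simpa using smul_mem_zeroLocus hI h1.1 2
  have hset : ∀ k, ‖u i k‖ = 1 ↔ ‖u j k‖ = 1 := fun k => Set.ext_iff.1 hΛ k
  obtain ⟨k₀, hk₀⟩ : ∃ k, ‖u i k‖ = 1 := by
    by_contra! h
    have := (pi_norm_lt_iff one_pos).2 fun k =>
      lt_of_le_of_ne (hn i ▸ norm_le_pi_norm (u i) k) (h k)
    exact this.ne (hn i)
  rw [LinearIndependent.pair_iff]
  intro s t hst
  have hk : ∀ k, ‖u i k‖ = 1 → s * u i k + t * u j k = 0 := fun k hk => congrFun hst ⟨k, hk⟩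
  have hnst : ‖s‖ = ‖t‖ := by
    have h1 := congrArg norm (eq_neg_of_add_eq_zero_left (hk k₀ hk₀))
    rwa [norm_neg, norm_mul, norm_mul, hk₀, (hset k₀).1 hk₀, mul_one, mul_one] at h1
  by_cases ht : t = 0
  · exact ⟨by rwa [ht, norm_zero, norm_eq_zero] at hnst, ht⟩
  -- a dependence would rotate `u i` to a point agreeing with `u j` on the unimodular coordinates
  exfalso
  have hc : ‖-(s / t)‖ = 1 := by
    rw [norm_neg, norm_div, hnst, div_self (norm_ne_zero_iff.2 ht)]
  have hci : ∀ k, ‖(-(s / t) • u i) k‖ = ‖u i k‖ := fun k => by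
    rw [Pi.smul_apply, norm_smul, hc, one_mul]
  have heq : -(s / t) • u i = u j :=
    hN.eq_of_unimodular_eq (fun z hz c => smul_mem_zeroLocus hI hz c)
      (smul_mem_zeroLocus hI (huZ i) _) (huZ j) (by rw [norm_smul, hc, hn, mul_one]) (hn j)
      (fun k => by rw [hci, hset]) fun k hk' => by
        rw [hci] at hk'
        rw [Pi.smul_apply, smul_eq_mul]
        field_simp
        linear_combination -hk k hk'
  refine hne i j hij ?_
  rw [← heq, disc_smul _ hc]

end Discs

end HardyPolydisc

theorem mainTheorem4 (d : ℕ) (I : Ideal (MvPolynomial (Fin d) ℂ))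
    (hI : I.IsHomogeneous (MvPolynomial.homogeneousSubmodule (Fin d) ℂ)) :
    (2 ≤ HardyPolydisc.varietyDim (MvPolynomial.zeroLocus ℂ I) →
      ¬ HardyPolydisc.EssentiallyNormal (HardyPolydisc.closureIdeal I)ᗮ) ∧
    (HardyPolydisc.EssentiallyNormal (HardyPolydisc.closureIdeal I)ᗮ →
      ¬ FiniteDimensional ℂ (HardyPolydisc.closureIdeal I)ᗮ →
        HardyPolydisc.ConditionA (MvPolynomial.zeroLocus ℂ I)) := by
  classical
  refine ⟨fun hdim hN => ?_, fun hN hinf => ?_⟩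
  · obtain ⟨E, hE⟩ := hN.exists_finset_lines hI
    refine HardyPolydisc.not_two_le_varietyDim (insert 0 E) (fun z hz => ?_) hdim
    by_cases hz0 : z = 0
    · exact ⟨0, Finset.mem_insert_self _ _, 0, by simp [hz0]⟩
    · obtain ⟨e, he, c, hc⟩ := hE z hz hz0
      exact ⟨e, Finset.mem_insert_of_mem he, c, hc⟩
  · obtain ⟨z, hz, hz0⟩ : ∃ z ∈ MvPolynomial.zeroLocus ℂ I, z ≠ 0 := by
      by_contra! h
      exact hinf (HardyPolydisc.finiteDimensional_of_zeroLocus_subset h)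
    exact ⟨hN.exists_isDiscDecomposition hI hz hz0,
      fun n u hu => Or.inr fun i j hij hΛ => hN.linearIndependent hI hu hij hΛ⟩
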